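/- Let $\alpha\ge 0$, $k=[\alpha]$, and let $q_\alpha:[0,1]\to\mathbb R$ be a kernel of the $N_{q_\alpha}$-method, i.e.: (1) $q_\alpha\ge 0$ on $[0,1]$; (2) $\int_0^1 q_\alpha(t)\,dt=1$; (3) the derivatives $q_\alpha^{(j)}$, $1\le j\le k-1$, exist and are absolutely continuous on $[0,1]$; (4) $q_\alpha^{(j)}(1)=0$ for $0\le j\le k-1$, and, if $k\ge 1$, $q_\alpha$ is continuous at $t=1$; (5) $q_\alpha^{(k)}$ exists on $(0,1)$; (6) $(-1)^kq_\alpha^{(k)}$ is nonnegative and monotonic increasing on $(0,1)$; (7) with $Q_k(t)=\int_{1-t}^1(-1)^kq_\alpha^{(k)}(u)\,du$, $$\int_0^t\frac{Q_k(u)}{u^{1+\alpha-k}}\,du=O\!\left(\frac{Q_k(t)}{t^{\alpha-k}}\right)\qquad(0<t\le 1).$$ A series $\sum u_n$ is called $|N_{q_\alpha}|$-summable if, for some $A>0$, $$\int_A^\infty\frac{dw}{w^2}\Bigl|\sum_{n\le w}n\,u_n\,q_\alpha\!\left(\frac nw\right)\Bigr|<\infty .$$ Let $f:\mathbb R\to\mathbb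 R$ be $2\pi$-periodic and Lebesgue integrable over $(-\pi,\pi)$, with Fourier coefficients $a_n,b_n$, and let $B_n(x)=b_n\cos nx-a_n\sin nx$ $(n\ge 1)$ be the terms of the conjugate series. Let $x\in\mathbb R$, let $r\ge 0$ be an integer, let $\theta_0,\dots,\theta_{r-1}$ be arbitrary real constants, and put $P(u)=\sum_{i=0}^{r-1}\frac{\theta_i}{i!}u^i$, $$h(u)=\frac{\{f(x+u)-P(u)\}-(-1)^r\{f(x-u)-P(-u)\}}{2u^r},$$ where $h$ is assumed to be Lebesgue integrable over $(0,\pi)$. Put $H_0=h$, $H_\rho(t)=\frac1{\Gamma(\rho)}\int_0^t(t-u)^{\rho-1}h(u)\,du$ for $\rho>0$, and $h_\rho(t)=\Gamma(1+\rho)\,t^{-\rho}H_\rho(t)$ for $\rho\ge 0$. **Theorem 2.** Let $\rho=\alpha-r-1$. If $\rho\ge 0$ and $$\int_0^\pi t^{-1}|h_\rho(t)|\,dt<\infty,$$ then the $r$-th derived series $\sum_{n\ge1}\left(\frac{d}{dx}\right)^rB_n(x)$ of the conjugate series of $f$ at $x$ is $|N_{q_\alpha}|$-summable. -/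

import Mathlib

open MeasureTheory Set

noncomputable section

/-- The `j`-th derivative of `q` on `[0, 1]` (one-sided at the end points). -/
def kerDeriv (q : ℝ → ℝ) (j : ℕ) : ℝ → ℝ :=
  iteratedDerivWithin j q (Icc (0 : ℝ) 1)

/-- `Q_k(t) = ∫_{1-t}^1 (-1)^k q^{(k)}(u) du`. -/
def kerTail (q : ℝ → ℝ) (k : ℕ) (t : ℝ) : ℝ :=
  ∫ u in (1 - t)..1, (-1 : ℝ) ^ k * kerDeriv q k u

/-- The class of kernels `q_α` of the `N_{q_α}`-method, with `k = [α]`.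
Only the values of `q` on `[0, 1]` matter. -/
structure IsNevanlinnaKernel (α : ℝ) (q : ℝ → ℝ) : Prop where
  nonneg : ∀ t ∈ Icc (0 : ℝ) 1, 0 ≤ q t
  /-- As the value is nonzero, this includes the integrability of `q`. -/
  integral_eq_one : ∫ t in (0 : ℝ)..1, q t = 1
  /-- The derivatives of order `1, …, k - 1` exist on `[0, 1]`. -/
  differentiableOn : ∀ j : ℕ, j + 1 < ⌊α⌋₊ →
    DifferentiableOn ℝ (kerDeriv q j) (Icc (0 : ℝ) 1)
  /-- The derivatives of order `1, …, k - 1` are absolutely continuous on `[0, 1]`. -/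
  absolutelyContinuous : ∀ j : ℕ, j + 1 < ⌊α⌋₊ →
    AbsolutelyContinuousOnInterval (kerDeriv q (j + 1)) 0 1
  /-- The derivatives of order `0, …, k - 1` vanish at `1`. -/
  deriv_at_one : ∀ j : ℕ, j < ⌊α⌋₊ → kerDeriv q j 1 = 0
  /-- For `k ≥ 1` the zero of `q` at `1` is attained continuously (automatic if `k ≥ 2`). -/
  continuous_at_one : 1 ≤ ⌊α⌋₊ → ContinuousWithinAt q (Icc (0 : ℝ) 1) 1
  /-- The `k`-th derivative exists on `(0, 1)`. -/
  differentiable_last : ∀ j : ℕ, j + 1 = ⌊α⌋₊ →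
    ∀ t ∈ Ioo (0 : ℝ) 1, DifferentiableAt ℝ (kerDeriv q j) t
  last_nonneg : ∀ t ∈ Ioo (0 : ℝ) 1, 0 ≤ (-1 : ℝ) ^ ⌊α⌋₊ * kerDeriv q ⌊α⌋₊ t
  last_monotone :
    MonotoneOn (fun t => (-1 : ℝ) ^ ⌊α⌋₊ * kerDeriv q ⌊α⌋₊ t) (Ioo (0 : ℝ) 1)
  /-- `∫_0^t Q_k(u) u^{-(1 + α - k)} du = O(Q_k(t) t^{-(α - k)})`, the integrals being finite. -/
  tail_bound : ∃ C : ℝ, ∀ t ∈ Ioc (0 : ℝ) 1,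
    IntervalIntegrable (fun u => kerTail q ⌊α⌋₊ u / u ^ (1 + α - (⌊α⌋₊ : ℝ))) volume 0 t ∧
    ∫ u in (0 : ℝ)..t, kerTail q ⌊α⌋₊ u / u ^ (1 + α - (⌊α⌋₊ : ℝ)) ≤
      C * (kerTail q ⌊α⌋₊ t / t ^ (α - (⌊α⌋₊ : ℝ)))

/-- The series `∑ u_n` is `|N_q|`-summable:
`∫_A^∞ w⁻² |∑_{n ≤ w} n u_n q(n/w)| dw < ∞` for some `A > 0`
(the term with `n = 0` is zero). -/
def AbsNSummable (q : ℝ → ℝ) (u : ℕ → ℝ) : Prop :=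
  ∃ A : ℝ, 0 < A ∧
    IntegrableOn
      (fun w : ℝ => |∑ n ∈ Finset.Icc 1 ⌊w⌋₊, (n : ℝ) * u n * q ((n : ℝ) / w)| / w ^ 2)
      (Ioi A) volume

/-- Fourier cosine coefficient `a_n`. -/
def fourierCosCoeff (f : ℝ → ℝ) (n : ℕ) : ℝ :=
  (1 / Real.pi) * ∫ t in (-Real.pi)..Real.pi, f t * Real.cos (n * t)

/-- Fourier sine coefficient `b_n`. -/
def fourierSinCoeff (f : ℝ → ℝ) (n : ℕ) : ℝ :=
  (1 / Real.pi) * ∫ t in (-Real.pi)..Real.pi, f t * Real.sin (n * t)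

/-- The `n`-th term `B_n(x) = b_n cos nx - a_n sin nx` of the conjugate series (`n ≥ 1`). -/
def conjTerm (f : ℝ → ℝ) (n : ℕ) (x : ℝ) : ℝ :=
  fourierSinCoeff f n * Real.cos (n * x) - fourierCosCoeff f n * Real.sin (n * x)

/-- The `n`-th term `(d/dx)^r B_n(x)` of the `r`-th derived conjugate series. -/
def derivedConjTerm (f : ℝ → ℝ) (r : ℕ) (x : ℝ) (n : ℕ) : ℝ :=
  iteratedDeriv r (conjTerm f n) x

/-- `P(u) = ∑_{i < r} θ_i u^i / i!`. -/
def thetaPoly (r : ℕ) (θ : ℕ → ℝ) (u : ℝ) : ℝ :=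
  ∑ i ∈ Finset.range r, θ i / (i.factorial : ℝ) * u ^ i

/-- `h(u) = ({f(x+u) - P(u)} - (-1)^r {f(x-u) - P(-u)}) / (2 u^r)`. -/
def hFun (f : ℝ → ℝ) (x : ℝ) (r : ℕ) (θ : ℕ → ℝ) (u : ℝ) : ℝ :=
  ((f (x + u) - thetaPoly r θ u) - (-1 : ℝ) ^ r * (f (x - u) - thetaPoly r θ (-u))) /
    (2 * u ^ r)

/-- Fractional integral: `H_0 = h`, and
`H_β(t) = Γ(β)⁻¹ ∫_0^t (t-u)^{β-1} h(u) du` for `β > 0`. -/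
def fracInt (h : ℝ → ℝ) (β t : ℝ) : ℝ :=
  if β = 0 then h t
  else (1 / Real.Gamma β) * ∫ u in (0 : ℝ)..t, (t - u) ^ (β - 1) * h u

/-- `h_β(t) = Γ(1+β) t^{-β} H_β(t)`. -/
def fracMean (h : ℝ → ℝ) (β t : ℝ) : ℝ :=
  Real.Gamma (1 + β) * t ^ (-β) * fracInt h β t

end

/-! The means `∑ n u_n q(n / w)` of the `r`-th derived conjugate series are integrals of `h` against
`G_w(u) = u ^ r S_w^{(r)}(u)`, where `S_w(u) = ∑_{n ≤ w} n q(n / w) sin (n u)`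
(`sum_derivedConjTerm_eq`); the polynomial `P` contributes only values of derivatives of `S_w` at `π`.
Write `k = ⌊α⌋₊ = κ + 1`, `m = κ - r` and `σ = α - k`, so that `ρ = m + σ` with `0 ≤ σ < 1`.
Fractional integration by parts (`exists_integral_mul_eq_fracInt`) moves `ρ` integrations onto `h`: up
to derivatives of `G_w` at `π`, the mean becomes a multiple of the integral of `H_ρ(t) X_w(t)` with
`X_w(t) = ∫_t^π (s - t) ^ (-σ) G_w^{(m + 1)}(s) ds`. It therefore suffices that
`∫ |X_w(t)| w ^ (-2) dw = O(t ^ (-1 - ρ))`, since `t⁻¹ |h_ρ(t)|` is integrable.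

The estimate of `S_w` rests on Taylor's formula at `1`: `q` is a mixture of truncated powers
`(v - s) ^ (k - 1)` with the increasing density `(-1) ^ k q^{(k)}(v)`. So `S_w` is a mixture of Riesz
sums `∑_{n ≤ y} (y - n) ^ l z ^ n` with `z = exp(i u)`, each of which is a polynomial in `y`, whose
coefficients are Abel sums, minus a bounded quasi-periodic function of `y`. The polynomial part comes
from the frequency `0`; its leading coefficient drops out of the sine series
(`im_I_pow_mul_abelMoment`), which leaves `O(w⁻¹ u ^ (-3 - j))` for the `j`-th derivative. The second
mean value estimate and the monotonicity of the density bound the quasi-periodic part by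
`w ^ (2 + j - k) u ^ (-k) Q_k(1 / (w u))` (`IsNevanlinnaKernel.exists_abs_kernelSum_le`).

Interpolation between `G_w^{(m)}` and `G_w^{(m + 1)}` at distance `1 / w` then yields
`|X_w(t)| w ^ (-2) ≤ C t ^ (-ρ) D(w t)` with an explicit profile `D`
(`IsNevanlinnaKernel.exists_abs_fracDeriv_weightedKernel_le`). After the substitution `v ↦ 1 / v` the
integrability of `D` on `(0, ∞)` is the finiteness of `∫_0^1 Q_k(u) u ^ (-(1 + α - k)) du`, which is
part of the tail condition on the kernel. Tonelli's theorem concludes. -/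

noncomputable section

/-! ### Abel sums of powers on the unit circle -/

/-- The Abel sum of `∑ n ^ m z ^ n` over `n ≥ 0`, a rational function of `z` with its only pole at `z = 1`.
It is defined by the recursion that comparing the series with its shift forces on it, so that no
limit is needed and `‖z‖ = 1` is allowed. -/
def abelMoment (z : ℂ) : ℕ → ℂ
  | 0 => (1 - z)⁻¹
  | m + 1 => z * (1 - z)⁻¹ * ∑ i : Fin (m + 1), ((m + 1).choose i : ℂ) * abelMoment z i

/-- The relation `A_m = 0 ^ m + z ∑ C(m, i) A_i`: splitting off the term `n = 0` and expanding
`(n + 1) ^ m`. -/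
theorem abelMoment_eq {z : ℂ} (hz : z ≠ 1) (m : ℕ) :
    abelMoment z m =
      0 ^ m + z * ∑ i ∈ Finset.range (m + 1), (m.choose i : ℂ) * abelMoment z i := by
  have h1 : 1 - z ≠ 0 := sub_ne_zero.mpr hz.symm
  cases m with
  | zero => simp [abelMoment]; field_simp; ring
  | succ m =>
    rw [Finset.sum_range_succ, Nat.choose_self]
    have h2 : abelMoment z (m + 1) = z * (1 - z)⁻¹ *
        ∑ i ∈ Finset.range (m + 1), ((m + 1).choose i : ℂ) * abelMoment z i := by
      rw [abelMoment, Finset.sum_range]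
    have h3 : (1 - z) * abelMoment z (m + 1) =
        z * ∑ i ∈ Finset.range (m + 1), ((m + 1).choose i : ℂ) * abelMoment z i := by
      rw [h2]; field_simp
    simp only [Nat.cast_one, one_mul, ne_eq, Nat.add_eq_zero_iff, one_ne_zero, and_false,
      not_false_eq_true, zero_pow, zero_add]
    linear_combination h3

theorem exists_norm_abelMoment_le (m : ℕ) : ∃ C : ℝ, 0 ≤ C ∧ ∀ z : ℂ, ‖z‖ = 1 → z ≠ 1 →
    ‖abelMoment z m‖ ≤ C / ‖1 - z‖ ^ (m + 1) := by
  induction m using Nat.strong_induction_on with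
  | _ m ih =>
    cases m with
    | zero => exact ⟨1, zero_le_one, fun z _ _ => by simp [abelMoment]⟩
    | succ m =>
      choose! C hC0 hC using ih
      refine ⟨∑ i : Fin (m + 1), ((m + 1).choose i : ℝ) * (C i * 2 ^ m),
        Finset.sum_nonneg fun i _ => by have := hC0 i i.2; positivity, fun z hz hz1 => ?_⟩
      have hpos : 0 < ‖1 - z‖ := norm_pos_iff.mpr (sub_ne_zero.mpr hz1.symm)
      have hle : ‖1 - z‖ ≤ 2 := by
        calc ‖1 - z‖ ≤ ‖(1 : ℂ)‖ + ‖z‖ := norm_sub_le _ _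
          _ = 2 := by rw [hz]; norm_num
      rw [abelMoment, norm_mul, norm_mul, norm_inv, hz, one_mul, pow_succ _ (m + 1),
        ← div_div, inv_mul_eq_div]
      gcongr
      rw [Finset.sum_div]
      refine (norm_sum_le _ _).trans (Finset.sum_le_sum fun i _ => ?_)
      rw [norm_mul, Complex.norm_natCast, mul_div_assoc]
      gcongr
      refine (hC i i.2 z hz hz1).trans ?_
      have hC0' := hC0 i i.2
      rw [div_le_div_iff₀ (by positivity) (by positivity), mul_assoc]
      gcongr
      have : ‖1 - z‖ ^ (m + 1) = ‖1 - z‖ ^ (m - i) * ‖1 - z‖ ^ ((i : ℕ) + 1) := by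
        rw [← pow_add]; congr 1; have := i.2; omega
      rw [this]
      gcongr
      calc ‖1 - z‖ ^ (m - i) ≤ 2 ^ (m - (i : ℕ)) := by gcongr
        _ ≤ 2 ^ m := pow_le_pow_right₀ (by norm_num) (by omega)

/-- The Abel sum `∑ p(n) z ^ n` over `n ≥ 0` as a linear functional of the polynomial `p`. -/
def abelSum (z : ℂ) : Polynomial ℂ →ₗ[ℂ] ℂ :=
  Polynomial.lsum fun i => LinearMap.id.smulRight (abelMoment z i)

theorem abelSum_X_pow (z : ℂ) (i : ℕ) : abelSum z (Polynomial.X ^ i) = abelMoment z i := by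
  rw [← Polynomial.monomial_one_right_eq_X_pow]
  simp [abelSum, Polynomial.lsum_apply, Polynomial.sum_monomial_index]

/-- Shift equation: the term `n = 0` is split off and the remaining series is reindexed. -/
theorem abelSum_comp_X_add_one {z : ℂ} (hz : z ≠ 1) (p : Polynomial ℂ) :
    abelSum z p = p.eval 0 + z * abelSum z (p.comp (Polynomial.X + 1)) := by
  induction p using Polynomial.induction_on' with
  | add p q hp hq =>
    rw [map_add, Polynomial.eval_add, Polynomial.add_comp, map_add, hp, hq]; ring
  | monomial n a =>
    rw [← Polynomial.C_mul_X_pow_eq_monomial, ← Polynomial.smul_eq_C_mul]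
    simp only [map_smul, Polynomial.eval_smul, Polynomial.smul_comp, smul_eq_mul,
      Polynomial.eval_pow, Polynomial.eval_X, Polynomial.X_pow_comp]
    rw [abelSum_X_pow, abelMoment_eq hz n, add_pow, map_sum]
    have : ∀ i ∈ Finset.range (n + 1), abelSum z
        (Polynomial.X ^ i * 1 ^ (n - i) * ((n.choose i : ℕ) : Polynomial ℂ)) =
        (n.choose i : ℂ) * abelMoment z i := fun i _ => by
      rw [one_pow, mul_one, mul_comm, ← abelSum_X_pow, ← smul_eq_mul (a := (n.choose i : ℂ)),
        ← map_smul, Polynomial.smul_eq_C_mul, Polynomial.C_eq_natCast]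
    rw [Finset.sum_congr rfl this]; ring

/-- A partial sum is the full Abel sum minus the Abel sum of the tail. -/
theorem sum_range_eval_mul_pow {z : ℂ} (hz : z ≠ 1) (p : Polynomial ℂ) (M : ℕ) :
    ∑ n ∈ Finset.range M, p.eval (n : ℂ) * z ^ n =
      abelSum z p - z ^ M * abelSum z (p.comp (Polynomial.X + Polynomial.C (M : ℂ))) := by
  induction M with
  | zero => simp
  | succ M ih =>
    rw [Finset.sum_range_succ, ih,
      abelSum_comp_X_add_one hz (p.comp (Polynomial.X + Polynomial.C (M : ℂ)))]
    rw [Polynomial.comp_assoc]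
    have : (Polynomial.X + Polynomial.C (M : ℂ)).comp (Polynomial.X + 1) =
        Polynomial.X + Polynomial.C ((M + 1 : ℕ) : ℂ) := by
      simp; ring
    rw [this, Polynomial.eval_comp]
    simp
    ring

/-- Abel summation assigns `0` to the two-sided series `∑ n ^ m z ^ n` over `n ∈ ℤ`. On the unit
circle the half over negative `n` is the conjugate of the half over positive `n`, up to sign. The
proof shows that the two-sided sums `D m` satisfy the homogeneous recursion. -/
theorem abelMoment_conj {z : ℂ} (hz : ‖z‖ = 1) (hz1 : z ≠ 1) (m : ℕ) :
    abelMoment z m = 0 ^ m - (-1) ^ m * (starRingEnd ℂ) (abelMoment z m) := by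
  have hzz : z * (starRingEnd ℂ) z = 1 := by
    rw [Complex.mul_conj, Complex.normSq_eq_norm_sq, hz]; simp
  set D : ℕ → ℂ := fun m => abelMoment z m - 0 ^ m + (-1) ^ m * (starRingEnd ℂ) (abelMoment z m)
    with hD
  have key : ∀ m, D m = z * ∑ i ∈ Finset.range (m + 1), (m.choose i : ℂ) * D i := by
    intro m
    have e1 := abelMoment_eq hz1 m
    have e2 : ∑ i ∈ Finset.range (m + 1), (m.choose i : ℂ) * 0 ^ i = 1 := by
      have := add_pow (0 : ℂ) 1 m
      simp only [zero_add, one_pow, mul_one] at this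
      rw [this]
      exact Finset.sum_congr rfl fun i _ => mul_comm _ _
    have e3 := abelSum_comp_X_add_one hz1 ((Polynomial.X - 1) ^ m)
    have e4 : ((Polynomial.X - 1 : Polynomial ℂ) ^ m).comp (Polynomial.X + 1) =
        Polynomial.X ^ m := by simp
    rw [e4, abelSum_X_pow] at e3
    have e5 : abelSum z ((Polynomial.X - 1) ^ m) = (-1) ^ m *
        ∑ i ∈ Finset.range (m + 1), (m.choose i : ℂ) * ((-1) ^ i * abelMoment z i) := by
      rw [sub_eq_add_neg, add_pow, map_sum, Finset.mul_sum]
      refine Finset.sum_congr rfl fun i hi => ?_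
      have : (Polynomial.X ^ i * (-1) ^ (m - i) * ((m.choose i : ℕ) : Polynomial ℂ)) =
          ((-1) ^ (m - i) * (m.choose i : ℂ)) • Polynomial.X ^ i := by
        rw [Polynomial.smul_eq_C_mul]; simp; ring
      rw [this, map_smul, abelSum_X_pow, smul_eq_mul]
      have h : ((-1 : ℂ)) ^ (m - i) = (-1) ^ m * (-1) ^ i := by
        have hi' : i ≤ m := by simpa [Nat.lt_succ_iff] using hi
        obtain ⟨d, rfl⟩ := Nat.exists_eq_add_of_le hi'
        rw [Nat.add_sub_cancel_left, pow_add, mul_comm ((-1 : ℂ) ^ i), mul_assoc, ← mul_pow]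
        simp
      rw [h]; ring
    rw [e5] at e3
    have e6 := congrArg (fun x => z * (starRingEnd ℂ) x) e3
    simp only [map_mul, map_add, map_sum, map_pow, map_neg, map_one, map_natCast] at e6
    have e7 : (starRingEnd ℂ) (Polynomial.eval 0 ((Polynomial.X - 1 : Polynomial ℂ) ^ m))
        = (-1) ^ m := by simp
    rw [e7] at e6
    have hs : ((-1 : ℂ) ^ m) * (-1) ^ m = 1 := by rw [← mul_pow]; simp
    have e8 : ∑ i ∈ Finset.range (m + 1), (m.choose i : ℂ) * D i =
        ∑ i ∈ Finset.range (m + 1), (m.choose i : ℂ) * abelMoment z i -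
        ∑ i ∈ Finset.range (m + 1), (m.choose i : ℂ) * 0 ^ i +
        ∑ i ∈ Finset.range (m + 1), (m.choose i : ℂ) *
          ((-1) ^ i * (starRingEnd ℂ) (abelMoment z i)) := by
      rw [← Finset.sum_sub_distrib, ← Finset.sum_add_distrib]
      exact Finset.sum_congr rfl fun i _ => by simp only [hD]; ring
    rw [e8, e2]
    simp only [hD]
    linear_combination e1 - (-1) ^ m * e6 +
      (z * ∑ i ∈ Finset.range (m + 1), (m.choose i : ℂ) *
          ((-1) ^ i * (starRingEnd ℂ) (abelMoment z i)) - z) * hs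
      - (-1) ^ m * (starRingEnd ℂ) (abelMoment z m) * hzz
  have hD0 : ∀ m, D m = 0 := by
    intro m
    induction m using Nat.strong_induction_on with
    | _ m ih =>
      have h := key m
      rw [Finset.sum_range_succ, Finset.sum_eq_zero fun i hi => by
        rw [ih i (Finset.mem_range.mp hi), mul_zero]] at h
      simp only [zero_add, Nat.choose_self, Nat.cast_one, one_mul] at h
      have : (1 - z) * D m = 0 := by linear_combination h
      exact (mul_eq_zero.mp this).resolve_left (sub_ne_zero.mpr hz1.symm)
  have := hD0 m
  simp only [hD] at this
  linear_combination this

/-- The `j`-th derivative of the sine series `∑ n sin (n u)` has Abel sum zero. This removes from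
the kernel the largest contribution of the frequency zero. -/
theorem im_I_pow_mul_abelMoment {z : ℂ} (hz : ‖z‖ = 1) (hz1 : z ≠ 1) (j : ℕ) :
    (Complex.I ^ j * abelMoment z (j + 1)).im = 0 := by
  rw [← Complex.conj_eq_iff_im, map_mul, map_pow, Complex.conj_I]
  conv_rhs => rw [abelMoment_conj hz hz1 (j + 1)]
  rw [neg_pow]
  simp
  ring

/-! ### Riesz sums and their oscillating parts -/

/-- The unnormalised Riesz sum `∑_{n ≤ y} (y - n) ^ l z ^ n`. -/
def rieszSum (z : ℂ) (l : ℕ) (y : ℝ) : ℂ :=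
  ∑ n ∈ Finset.range (⌊y⌋₊ + 1), ((y - n : ℝ) : ℂ) ^ l * z ^ n

/-- The oscillating part of a Riesz sum, with the opposite sign: the Riesz sum is a polynomial in
`y` minus this function, which is quasi-periodic (`E (y + 1) = z E y`) and hence bounded in `y`. -/
def rieszOsc (z : ℂ) (l : ℕ) (y : ℝ) : ℂ :=
  abelSum z ((Polynomial.C (y : ℂ) - Polynomial.X) ^ l) - rieszSum z l y

theorem abelSum_X_pow_mul_sub_pow (z : ℂ) (p l : ℕ) (y : ℂ) :
    abelSum z (Polynomial.X ^ p * (Polynomial.C y - Polynomial.X) ^ l) =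
      ∑ i ∈ Finset.range (l + 1),
        (l.choose i : ℂ) * y ^ (l - i) * (-1) ^ i * abelMoment z (p + i) := by
  rw [sub_eq_add_neg, add_comm (Polynomial.C y), add_pow, Finset.mul_sum, map_sum]
  refine Finset.sum_congr rfl fun i _ => ?_
  have : Polynomial.X ^ p * ((-Polynomial.X) ^ i * Polynomial.C y ^ (l - i) *
      ((l.choose i : ℕ) : Polynomial ℂ)) =
      ((l.choose i : ℂ) * y ^ (l - i) * (-1) ^ i) • Polynomial.X ^ (p + i) := by
    rw [Polynomial.smul_eq_C_mul, neg_pow]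
    simp
    ring
  rw [this, map_smul, abelSum_X_pow, smul_eq_mul]

theorem abelSum_sub_pow (z : ℂ) (l : ℕ) (y : ℂ) :
    abelSum z ((Polynomial.C y - Polynomial.X) ^ l) =
      ∑ i ∈ Finset.range (l + 1),
        (l.choose i : ℂ) * y ^ (l - i) * (-1) ^ i * abelMoment z i := by
  simpa using abelSum_X_pow_mul_sub_pow z 0 l y

/-- `(y - X) ^ (l + 1)` may be differentiated in `y` under the Abel sum. -/
theorem hasDerivAt_abelSum_sub_pow (z : ℂ) (l : ℕ) (y : ℝ) :
    HasDerivAt (fun y : ℝ => abelSum z ((Polynomial.C (y : ℂ) - Polynomial.X) ^ (l + 1)))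
      ((l + 1) * abelSum z ((Polynomial.C (y : ℂ) - Polynomial.X) ^ l)) y := by
  simp_rw [abelSum_sub_pow]
  rw [Finset.mul_sum]
  have h : ∀ i ∈ Finset.range (l + 2), HasDerivAt (fun y : ℝ =>
      ((l + 1).choose i : ℂ) * (y : ℂ) ^ (l + 1 - i) * (-1) ^ i * abelMoment z i)
      (((l + 1).choose i : ℂ) * ((l + 1 - i : ℕ) * (y : ℂ) ^ (l + 1 - i - 1)) * (-1) ^ i *
        abelMoment z i) y := by
    intro i _
    have h1 : HasDerivAt (fun y : ℝ => (y : ℂ) ^ (l + 1 - i))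
        ((l + 1 - i : ℕ) * (y : ℂ) ^ (l + 1 - i - 1)) y := by
      simpa using (hasDerivAt_pow (l + 1 - i) (y : ℂ)).comp_ofReal
    exact ((h1.const_mul _).mul_const _).mul_const _
  refine (HasDerivAt.fun_sum h).congr_deriv ?_
  rw [Finset.sum_range_succ]
  simp only [Nat.choose_self, Nat.sub_self, Nat.cast_zero, zero_mul, mul_zero, add_zero]
  refine Finset.sum_congr rfl fun i hi => ?_
  have hi' : i < l + 1 := Finset.mem_range.mp hi
  have h2 := congrArg (Nat.cast (R := ℂ)) (Nat.choose_mul_succ_eq l i)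
  push_cast [Nat.cast_sub hi'.le] at h2 ⊢
  have h3 : l + 1 - i - 1 = l - i := by omega
  rw [h3]
  linear_combination (-(y : ℂ) ^ (l - i) * (-1) ^ i * abelMoment z i) * h2

/-- Closed form of the oscillating part: the tail sum after `⌊y⌋₊`, in which only the fractional
part of `y` enters. -/
theorem rieszOsc_eq {z : ℂ} (hz : z ≠ 1) (l : ℕ) (y : ℝ) :
    rieszOsc z l y = z ^ (⌊y⌋₊ + 1) *
      abelSum z ((Polynomial.C ((y - (⌊y⌋₊ + 1) : ℝ) : ℂ) - Polynomial.X) ^ l) := by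
  have h := sum_range_eval_mul_pow hz ((Polynomial.C (y : ℂ) - Polynomial.X) ^ l) (⌊y⌋₊ + 1)
  have h1 : ((Polynomial.C (y : ℂ) - Polynomial.X) ^ l).comp
      (Polynomial.X + Polynomial.C ((⌊y⌋₊ + 1 : ℕ) : ℂ)) =
      (Polynomial.C ((y - (⌊y⌋₊ + 1) : ℝ) : ℂ) - Polynomial.X) ^ l := by
    simp only [Polynomial.pow_comp, Polynomial.sub_comp, Polynomial.C_comp, Polynomial.X_comp]
    congr 1
    simp
    ring
  rw [h1] at h
  rw [rieszOsc, rieszSum]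
  simp only [Polynomial.eval_pow, Polynomial.eval_sub, Polynomial.eval_C, Polynomial.eval_X] at h
  push_cast at h ⊢
  rw [h]
  ring

theorem exists_norm_rieszOsc_le (l : ℕ) : ∃ C : ℝ, 0 ≤ C ∧ ∀ z : ℂ, ‖z‖ = 1 → z ≠ 1 →
    ∀ y : ℝ, 0 ≤ y → ‖rieszOsc z l y‖ ≤ C / ‖1 - z‖ ^ (l + 1) := by
  choose C hC0 hC using exists_norm_abelMoment_le
  refine ⟨∑ i ∈ Finset.range (l + 1), (l.choose i : ℝ) * (C i * 2 ^ l),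
    Finset.sum_nonneg fun i _ => by have := hC0 i; positivity, fun z hz hz1 y hy => ?_⟩
  have hpos : 0 < ‖1 - z‖ := norm_pos_iff.mpr (sub_ne_zero.mpr hz1.symm)
  have hle : ‖1 - z‖ ≤ 2 := by
    calc ‖1 - z‖ ≤ ‖(1 : ℂ)‖ + ‖z‖ := norm_sub_le _ _
      _ = 2 := by rw [hz]; norm_num
  rw [rieszOsc_eq hz1, abelSum_sub_pow, norm_mul, norm_pow, hz, one_pow, one_mul, Finset.sum_div]
  refine (norm_sum_le _ _).trans (Finset.sum_le_sum fun i hi => ?_)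
  have hi' : i ≤ l := Nat.lt_succ_iff.mp (Finset.mem_range.mp hi)
  have hy1 : ‖((y - (⌊y⌋₊ + 1) : ℝ) : ℂ)‖ ≤ 1 := by
    rw [Complex.norm_real, Real.norm_eq_abs, abs_le]
    have := Nat.floor_le hy
    have := Nat.lt_floor_add_one y
    constructor <;> linarith
  rw [norm_mul, norm_mul, norm_mul, norm_pow, norm_pow, norm_neg, norm_one, one_pow, mul_one,
    Complex.norm_natCast, mul_assoc, mul_div_assoc]
  gcongr
  calc ‖((y - (⌊y⌋₊ + 1) : ℝ) : ℂ)‖ ^ (l - i) * ‖abelMoment z i‖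
      ≤ 1 * (C i / ‖1 - z‖ ^ (i + 1)) := by
        gcongr
        · exact pow_le_one₀ (norm_nonneg _) hy1
        · exact hC i z hz hz1
    _ ≤ C i * 2 ^ l / ‖1 - z‖ ^ (l + 1) := by
        have := hC0 i
        rw [one_mul, div_le_div_iff₀ (by positivity) (by positivity), mul_assoc]
        gcongr
        have : ‖1 - z‖ ^ (l + 1) = ‖1 - z‖ ^ (l - i) * ‖1 - z‖ ^ (i + 1) := by
          rw [← pow_add]; congr 1; omega
        rw [this]
        gcongr
        calc ‖1 - z‖ ^ (l - i) ≤ 2 ^ (l - i) := by gcongr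
          _ ≤ 2 ^ l := pow_le_pow_right₀ (by norm_num) (by omega)

/-- With truncated powers the range of summation is locally constant, which makes the continuity
of Riesz sums of positive order visible. -/
theorem rieszSum_eq_sum_max (z : ℂ) (l : ℕ) {y : ℝ} (hy : 0 ≤ y) {M : ℕ} (hM : y ≤ M) :
    rieszSum z (l + 1) y =
      ∑ n ∈ Finset.range (M + 1), ((max (y - n) 0 : ℝ) : ℂ) ^ (l + 1) * z ^ n := by
  have hsub : Finset.range (⌊y⌋₊ + 1) ⊆ Finset.range (M + 1) := by
    rw [Finset.range_subset_range]
    have := Nat.floor_le_of_le hM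
    omega
  rw [rieszSum, ← Finset.sum_subset hsub]
  · refine Finset.sum_congr rfl fun n hn => ?_
    have : (n : ℝ) ≤ y := (Nat.le_floor_iff hy).mp (Nat.lt_succ_iff.mp (Finset.mem_range.mp hn))
    rw [max_eq_left (by linarith)]
  · intro n _ hn
    have h1 : ⌊y⌋₊ < n := by
      have := mt Finset.mem_range.mpr hn
      omega
    have : y < n := (Nat.floor_lt hy).mp h1
    rw [max_eq_right (by linarith)]
    simp

theorem hasDerivAt_rieszSum (z : ℂ) (l : ℕ) {y : ℝ} (hy : 0 < y) (hyn : ∀ n : ℕ, y ≠ n) :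
    HasDerivAt (rieszSum z (l + 1)) ((l + 1) * rieszSum z l y) y := by
  have hev : ∀ᶠ x in nhds y, rieszSum z (l + 1) x =
      ∑ n ∈ Finset.range (⌊y⌋₊ + 1), ((x - n : ℝ) : ℂ) ^ (l + 1) * z ^ n := by
    have h1 : (⌊y⌋₊ : ℝ) < y := lt_of_le_of_ne (Nat.floor_le hy.le) (hyn _).symm
    filter_upwards [Ioo_mem_nhds h1 (Nat.lt_floor_add_one y)] with x hx
    have : ⌊x⌋₊ = ⌊y⌋₊ := by
      rw [Nat.floor_eq_iff ((Nat.cast_nonneg _).trans hx.1.le)]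
      exact ⟨hx.1.le, hx.2⟩
    rw [rieszSum, this]
  refine HasDerivAt.congr_of_eventuallyEq ?_ hev
  rw [rieszSum, Finset.mul_sum]
  refine (HasDerivAt.fun_sum (A' := fun n : ℕ => ((l + 1) * ((y - n : ℝ) : ℂ) ^ l) * z ^ n)
    fun n _ => ?_).congr_deriv (Finset.sum_congr rfl fun n _ => by ring)
  have h1 : HasDerivAt (fun x : ℝ => ((x - n : ℝ) : ℂ)) 1 y := by
    simpa using ((hasDerivAt_id y).sub_const (n : ℝ)).ofReal_comp
  simpa using (h1.fun_pow (l + 1)).mul_const (z ^ n)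

theorem measurable_natFloor_apply {E : Type*} [MeasurableSpace E] {F : ℕ → ℝ → E}
    (hF : ∀ M, Measurable (F M)) : Measurable fun y : ℝ => F ⌊y⌋₊ y := by
  have h : Measurable (Function.uncurry F) := measurable_from_prod_countable_right hF
  exact h.comp (Nat.measurable_floor.prodMk measurable_id)

theorem measurable_rieszSum (z : ℂ) (l : ℕ) : Measurable (rieszSum z l) :=
  measurable_natFloor_apply (F := fun M y =>
    ∑ n ∈ Finset.range (M + 1), ((y - n : ℝ) : ℂ) ^ l * z ^ n) fun M =>
      Finset.measurable_fun_sum (Finset.range (M + 1))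
        (f := fun (n : ℕ) (y : ℝ) => ((y - n : ℝ) : ℂ) ^ l * z ^ n) fun n _ => by fun_prop

theorem continuous_abelSum_sub_pow (z : ℂ) (l : ℕ) :
    Continuous fun y : ℝ => abelSum z ((Polynomial.C (y : ℂ) - Polynomial.X) ^ l) := by
  simp_rw [abelSum_sub_pow]
  fun_prop

theorem measurable_rieszOsc (z : ℂ) (l : ℕ) : Measurable (rieszOsc z l) :=
  (continuous_abelSum_sub_pow z l).measurable.sub (measurable_rieszSum z l)

theorem intervalIntegrable_rieszOsc {z : ℂ} (hz : ‖z‖ = 1) (hz1 : z ≠ 1) (l : ℕ) {a b : ℝ}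
    (ha : 0 ≤ a) (hb : 0 ≤ b) : IntervalIntegrable (rieszOsc z l) volume a b := by
  obtain ⟨C, -, hC⟩ := exists_norm_rieszOsc_le l
  refine IntervalIntegrable.mono_fun' (g := fun _ => C / ‖1 - z‖ ^ (l + 1))
    intervalIntegrable_const (measurable_rieszOsc z l).aestronglyMeasurable ?_
  refine (ae_restrict_iff' measurableSet_uIoc).mpr (Filter.Eventually.of_forall fun y hy => ?_)
  exact hC z hz hz1 y ((le_min ha hb).trans (mem_uIoc.mp hy |>.elim
    (fun h => (min_le_left a b).trans h.1.le) (fun h => (min_le_right a b).trans h.1.le)))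

/-- Oscillating parts of consecutive orders are primitives of each other. As they are bounded, every
integration gains a factor `1 / ‖1 - z‖`. -/
theorem integral_rieszOsc {z : ℂ} (hz : ‖z‖ = 1) (hz1 : z ≠ 1) (l : ℕ) {a b : ℝ}
    (ha : 0 ≤ a) (hab : a ≤ b) : ∫ y in a..b, ((l + 1 : ℝ) : ℂ) * rieszOsc z l y =
      rieszOsc z (l + 1) b - rieszOsc z (l + 1) a := by
  obtain ⟨M, hM⟩ := exists_nat_ge b
  refine integral_eq_of_hasDerivAt_off_countable_of_le _ _ hab
    (s := range ((↑) : ℕ → ℝ)) (countable_range _) ?_ ?_ ?_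
  · refine ContinuousOn.sub (continuous_abelSum_sub_pow z (l + 1)).continuousOn ?_
    refine ContinuousOn.congr (f := fun y : ℝ => ∑ n ∈ Finset.range (M + 1),
      ((max (y - n) 0 : ℝ) : ℂ) ^ (l + 1) * z ^ n) (by fun_prop) ?_
    exact fun y hy => rieszSum_eq_sum_max z l (ha.trans hy.1) (hy.2.trans hM)
  · intro y hy
    have h := (hasDerivAt_abelSum_sub_pow z l y).sub (hasDerivAt_rieszSum z l
      (ha.trans_lt hy.1.1) fun n hn => hy.2 ⟨n, hn.symm⟩)
    refine h.congr_deriv ?_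
    rw [rieszOsc]; push_cast; ring
  · exact (intervalIntegrable_rieszOsc hz hz1 l ha (ha.trans hab)).const_mul _

/-- A weight `n ^ p` is expanded around `y`, which leaves powers of `y` (monotone in `y`) times
oscillating parts. -/
theorem sum_pow_mul_sub_pow {z : ℂ} (p l : ℕ) (y : ℝ) :
    ∑ n ∈ Finset.range (⌊y⌋₊ + 1), (n : ℂ) ^ p * ((y - n : ℝ) : ℂ) ^ l * z ^ n =
      ∑ i ∈ Finset.range (l + 1),
        (l.choose i : ℂ) * y ^ (l - i) * (-1) ^ i * abelMoment z (p + i) -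
      ∑ i ∈ Finset.range (p + 1),
        (p.choose i : ℂ) * (-1) ^ i * (y : ℂ) ^ (p - i) * rieszOsc z (l + i) y := by
  have h1 : ∑ n ∈ Finset.range (⌊y⌋₊ + 1), (n : ℂ) ^ p * ((y - n : ℝ) : ℂ) ^ l * z ^ n =
      ∑ i ∈ Finset.range (p + 1),
        (p.choose i : ℂ) * (-1) ^ i * (y : ℂ) ^ (p - i) * rieszSum z (l + i) y := by
    simp_rw [rieszSum, Finset.mul_sum]
    rw [Finset.sum_comm]
    refine Finset.sum_congr rfl fun n _ => ?_
    have : (n : ℂ) ^ p = (-((y - n : ℝ) : ℂ) + y) ^ p := by push_cast; ring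
    rw [this, add_pow, Finset.sum_mul, Finset.sum_mul]
    refine Finset.sum_congr rfl fun i _ => ?_
    rw [neg_pow, pow_add]; ring
  have h2 : ∑ i ∈ Finset.range (l + 1),
        (l.choose i : ℂ) * y ^ (l - i) * (-1) ^ i * abelMoment z (p + i) =
      ∑ i ∈ Finset.range (p + 1), (p.choose i : ℂ) * (-1) ^ i * (y : ℂ) ^ (p - i) *
        abelSum z ((Polynomial.C (y : ℂ) - Polynomial.X) ^ (l + i)) := by
    rw [← abelSum_X_pow_mul_sub_pow]
    have : (Polynomial.X : Polynomial ℂ) ^ p =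
        (-(Polynomial.C (y : ℂ) - Polynomial.X) + Polynomial.C (y : ℂ)) ^ p := by
      congr 1; ring
    rw [this, add_pow, Finset.sum_mul, map_sum]
    refine Finset.sum_congr rfl fun i _ => ?_
    rw [← smul_eq_mul (a := (p.choose i : ℂ) * (-1) ^ i * (y : ℂ) ^ (p - i)), ← map_smul,
      Polynomial.smul_eq_C_mul, neg_pow]
    congr 1
    simp
    ring
  rw [h1, h2, ← Finset.sum_sub_distrib]
  exact Finset.sum_congr rfl fun i _ => by rw [rieszOsc]; ring

/-! ### The second mean value estimate -/

/-- Up to a null set, a superlevel set of a monotone function in `(a, b]` is an interval `(c, b]`. -/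
theorem exists_ae_eq_Ioc_of_monotone {g : ℝ → ℝ} (hg : Monotone g) {a b : ℝ} (hab : a ≤ b)
    (s : ℝ) : ∃ c ∈ Icc a b, (Ioc a b ∩ {y | s < g y} : Set ℝ) =ᵐ[volume] Ioc c b := by
  set V : Set ℝ := insert b (Ioc a b ∩ {y | s < g y}) with hV
  have hVbdd : BddBelow V := ⟨a, by
    rintro y (rfl | hy)
    · exact hab
    · exact hy.1.1.le⟩
  have hVne : V.Nonempty := ⟨b, mem_insert _ _⟩
  have hca : a ≤ sInf V := le_csInf hVne (by
    rintro y (rfl | hy)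
    · exact hab
    · exact hy.1.1.le)
  refine ⟨sInf V, ⟨hca, csInf_le hVbdd (mem_insert _ _)⟩, ?_⟩
  have h1 : Ioc (sInf V) b ⊆ Ioc a b ∩ {y | s < g y} := by
    intro y hy
    obtain ⟨u, hu, huy⟩ := exists_lt_of_csInf_lt hVne hy.1
    refine ⟨⟨hca.trans_lt hy.1, hy.2⟩, ?_⟩
    rcases hu with rfl | hu
    · exact absurd huy (not_lt.mpr hy.2)
    · exact lt_of_lt_of_le hu.2 (hg huy.le)
  have h2 : Ioc a b ∩ {y | s < g y} ⊆ Icc (sInf V) b := fun y hy =>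
    ⟨csInf_le hVbdd (mem_insert_of_mem _ hy), hy.1.2⟩
  exact ((LE.le.eventuallyLE h2).trans Ioc_ae_eq_Icc.symm.le).antisymm
    (LE.le.eventuallyLE h1)

/-- Second mean value estimate, by the layer cake formula: `g` is the average over levels `s` of the
indicators of `{g > s}`, and `E` is integrated over an end interval for each level. -/
theorem norm_integral_mul_le_of_monotone {g : ℝ → ℝ} {E : ℝ → ℂ} {a b M : ℝ} (hab : a < b)
    (hg : Monotone g) (hg0 : ∀ y ∈ Ioc a b, 0 ≤ g y) (hE : IntervalIntegrable E volume a b)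
    (hM : ∀ c ∈ Icc a b, ‖∫ y in c..b, E y‖ ≤ M) :
    ‖∫ y in a..b, (g y : ℂ) * E y‖ ≤ g b * M := by
  have hgb : 0 ≤ g b := hg0 b ⟨hab, le_rfl⟩
  have hE' : IntegrableOn E (Ioc a b) := (intervalIntegrable_iff_integrableOn_Ioc_of_le hab.le).mp hE
  set S : Set (ℝ × ℝ) := {p | p.2 < g p.1} with hS
  have hSm : MeasurableSet S :=
    measurableSet_lt measurable_snd (hg.measurable.comp measurable_fst)
  set F : ℝ → ℝ → ℂ := fun y s => S.indicator (fun p => E p.1) (y, s) with hF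
  have hFint : Integrable (Function.uncurry F)
      ((volume.restrict (Ioc a b)).prod (volume.restrict (Ioc 0 (g b)))) :=
    (Integrable.comp_fst hE' _).indicator hSm
  have h1 : ∀ y ∈ Ioc a b, ∫ s in Ioc 0 (g b), F y s = (g y : ℂ) * E y := by
    intro y hy
    have : ∀ s, F y s = (Iio (g y)).indicator (fun _ => E y) s := fun s => rfl
    simp_rw [this]
    rw [integral_indicator measurableSet_Iio, Measure.restrict_restrict measurableSet_Iio]
    have h2 : Iio (g y) ∩ Ioc 0 (g b) = Ioo 0 (g y) := by
      ext s
      have := hg hy.2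
      simp only [mem_inter_iff, mem_Iio, mem_Ioc, mem_Ioo]
      constructor
      · rintro ⟨h, h', -⟩; exact ⟨h', h⟩
      · rintro ⟨h, h'⟩; exact ⟨h', h, (h'.le.trans this)⟩
    rw [h2, setIntegral_const, measureReal_def, Real.volume_Ioo, sub_zero,
      ENNReal.toReal_ofReal (hg0 y hy), Complex.real_smul]
  have h2 : ∀ s, ∫ y in Ioc a b, F y s = ∫ y in Ioc a b ∩ {y | s < g y}, E y := by
    intro s
    have hm : MeasurableSet {y | s < g y} := measurableSet_lt measurable_const hg.measurable
    have : ∀ y, F y s = {y | s < g y}.indicator E y := fun s => rfl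
    simp_rw [this]
    rw [integral_indicator hm, Measure.restrict_restrict hm, inter_comm]
  have h3 : ∀ s, ‖∫ y in Ioc a b, F y s‖ ≤ M := by
    intro s
    obtain ⟨c, hc, hcs⟩ := exists_ae_eq_Ioc_of_monotone hg hab.le s
    rw [h2, setIntegral_congr_set hcs, ← intervalIntegral.integral_of_le hc.2]
    exact hM c hc
  rw [intervalIntegral.integral_of_le hab.le, ← setIntegral_congr_fun measurableSet_Ioc h1,
    integral_integral_swap hFint]
  have h4 := norm_setIntegral_le_of_norm_le_const (μ := volume) (s := Ioc 0 (g b))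
    (f := fun s => ∫ y in Ioc a b, F y s) (C := M) (by simp) (fun s _ => h3 s)
  rwa [measureReal_def, Real.volume_Ioc, sub_zero, ENNReal.toReal_ofReal hgb, mul_comm] at h4

/-- Second mean value estimate for a weight that is nonnegative and monotone on the interval only. -/
theorem norm_integral_mul_le_of_monotoneOn {g : ℝ → ℝ} {E : ℝ → ℂ} {a b M : ℝ} (hab : a < b)
    (hg : MonotoneOn g (Ioc a b)) (hg0 : ∀ y ∈ Ioc a b, 0 ≤ g y)
    (hE : IntervalIntegrable E volume a b) (hM : ∀ c ∈ Icc a b, ‖∫ y in c..b, E y‖ ≤ M) :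
    ‖∫ y in a..b, (g y : ℂ) * E y‖ ≤ g b * M := by
  have hb : b ∈ Ioc a b := ⟨hab, le_rfl⟩
  obtain ⟨g', hg', heq⟩ := hg.exists_monotone_extension
    ⟨0, by rintro _ ⟨y, hy, rfl⟩; exact hg0 y hy⟩
    ⟨g b, by rintro _ ⟨y, hy, rfl⟩; exact hg hy hb hy.2⟩
  have h := norm_integral_mul_le_of_monotone hab hg' (fun y hy => heq hy ▸ hg0 y hy) hE hM
  rw [← heq hb] at h
  rwa [intervalIntegral.integral_congr_ae (g := fun y => (g' y : ℂ) * E y)]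
  refine Filter.Eventually.of_forall fun y hy => ?_
  rw [uIoc_of_le hab.le] at hy
  rw [heq hy]

/-- The function `(-1) ^ k q^{(k)}`, nonnegative and increasing on `(0, 1)`, whose integrals over
end intervals are the values of `kerTail`. -/
def kerTop (q : ℝ → ℝ) (k : ℕ) (v : ℝ) : ℝ := (-1 : ℝ) ^ k * kerDeriv q k v

theorem kerDeriv_succ_eq_deriv (q : ℝ → ℝ) (j : ℕ) {t : ℝ} (ht : t ∈ Ioo (0 : ℝ) 1) :
    kerDeriv q (j + 1) t = deriv (kerDeriv q j) t := by
  rw [kerDeriv, iteratedDerivWithin_succ]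
  exact derivWithin_of_mem_nhds (Icc_mem_nhds ht.1 ht.2)

namespace IsNevanlinnaKernel

variable {α : ℝ} {q : ℝ → ℝ} {κ : ℕ}

theorem hasDerivAt_last (hq : IsNevanlinnaKernel α q) (hκ : ⌊α⌋₊ = κ + 1) {t : ℝ}
    (ht : t ∈ Ioo (0 : ℝ) 1) : HasDerivAt (kerDeriv q κ) (kerDeriv q (κ + 1) t) t := by
  rw [kerDeriv_succ_eq_deriv q κ ht]
  exact (hq.differentiable_last κ hκ.symm t ht).hasDerivAt

theorem continuousOn_last (hq : IsNevanlinnaKernel α q) (hκ : ⌊α⌋₊ = κ + 1) :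
    ContinuousOn (kerDeriv q κ) (Ioc (0 : ℝ) 1) := by
  cases κ with
  | zero =>
    intro t ht
    rcases eq_or_lt_of_le ht.2 with rfl | h1
    · have : kerDeriv q 0 = q := by ext; simp [kerDeriv]
      rw [this]
      exact (hq.continuous_at_one (by omega)).mono Ioc_subset_Icc_self
    · exact (hq.hasDerivAt_last hκ ⟨ht.1, h1⟩).continuousAt.continuousWithinAt
  | succ j =>
    have := (hq.absolutelyContinuous j (by omega)).continuousOn
    rw [uIcc_of_le zero_le_one] at this
    exact this.mono Ioc_subset_Icc_self

theorem kerTop_nonneg (hq : IsNevanlinnaKernel α q) (hκ : ⌊α⌋₊ = κ + 1) {v : ℝ}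
    (hv : v ∈ Ioo (0 : ℝ) 1) : 0 ≤ kerTop q (κ + 1) v := by
  have := hq.last_nonneg v hv
  rwa [hκ] at this

theorem kerTop_monotoneOn (hq : IsNevanlinnaKernel α q) (hκ : ⌊α⌋₊ = κ + 1) :
    MonotoneOn (kerTop q (κ + 1)) (Ioo (0 : ℝ) 1) := by
  have := hq.last_monotone
  rwa [hκ] at this

/-- Near `0` the function is bounded by monotonicity; near `1` it is a derivative of constant sign
of a function continuous up to the end point. -/
theorem intervalIntegrable_kerTop (hq : IsNevanlinnaKernel α q) (hκ : ⌊α⌋₊ = κ + 1) :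
    IntervalIntegrable (kerTop q (κ + 1)) volume 0 1 := by
  refine IntervalIntegrable.trans (b := 1 / 2) ?_ ?_
  · rw [intervalIntegrable_iff_integrableOn_Ioc_of_le (by norm_num)]
    have hsub : Ioc (0 : ℝ) (1 / 2) ⊆ Ioo 0 1 := fun y hy => ⟨hy.1, by linarith [hy.2]⟩
    refine Integrable.of_bound (aemeasurable_restrict_of_monotoneOn measurableSet_Ioc
        ((hq.kerTop_monotoneOn hκ).mono hsub)).aestronglyMeasurable (kerTop q (κ + 1) (1 / 2)) ?_
    refine (ae_restrict_iff' measurableSet_Ioc).mpr (Filter.Eventually.of_forall fun y hy => ?_)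
    rw [Real.norm_eq_abs, abs_of_nonneg (hq.kerTop_nonneg hκ (hsub hy))]
    exact hq.kerTop_monotoneOn hκ (hsub hy) (by norm_num) hy.2
  · rw [intervalIntegrable_iff_integrableOn_Ioc_of_le (by norm_num)]
    refine intervalIntegral.integrableOn_deriv_of_nonneg
      (g := fun v => (-1 : ℝ) ^ (κ + 1) * kerDeriv q κ v) ?_ ?_ ?_
    · have hsub : Icc (1 / 2 : ℝ) 1 ⊆ Ioc 0 1 := fun y hy => ⟨by linarith [hy.1], hy.2⟩
      exact continuousOn_const.mul ((hq.continuousOn_last hκ).mono hsub)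
    · intro y hy
      exact (hq.hasDerivAt_last hκ ⟨by linarith [hy.1], hy.2⟩).const_mul _
    · intro y hy
      exact hq.kerTop_nonneg hκ ⟨by linarith [hy.1], hy.2⟩

/-- Taylor's formula at `1` for the kernel, all lower derivatives vanishing there: `q` is a mixture
of truncated powers with density `(-1) ^ k q^{(k)}`. For `κ = 0` the kernel need not be continuous
at `0`, so that case does not go through the Taylor polynomial on `[0, 1]`. -/
theorem eq_integral (hq : IsNevanlinnaKernel α q) (hκ : ⌊α⌋₊ = κ + 1) {s : ℝ}
    (hs : s ∈ Ioc (0 : ℝ) 1) :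
    q s = (κ.factorial : ℝ)⁻¹ * ∫ v in s..1, (v - s) ^ κ * kerTop q (κ + 1) v := by
  obtain ⟨F, hFc, hFd, hFs, hF1⟩ : ∃ F : ℝ → ℝ, ContinuousOn F (Icc s 1) ∧
      (∀ v ∈ Ioo s 1, HasDerivAt F ((κ.factorial : ℝ)⁻¹ * (s - v) ^ κ * kerDeriv q (κ + 1) v) v) ∧
      F s = q s ∧ F 1 = 0 := by
    rcases Nat.eq_zero_or_pos κ with rfl | hpos
    · have h0 : kerDeriv q 0 = q := by ext; simp [kerDeriv]
      refine ⟨q, ?_, fun v hv => ?_, rfl, ?_⟩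
      · have := hq.continuousOn_last hκ
        rw [h0] at this
        exact this.mono fun y hy => ⟨hs.1.trans_le hy.1, hy.2⟩
      · have := hq.hasDerivAt_last hκ ⟨hs.1.trans hv.1, hv.2⟩
        rw [h0] at this
        simpa using this
      · have := hq.deriv_at_one 0 (by omega)
        rwa [h0] at this
    · have hu : UniqueDiffOn ℝ (Icc (0 : ℝ) 1) := uniqueDiffOn_Icc zero_lt_one
      have hcd : ContDiffOn ℝ κ q (Icc (0 : ℝ) 1) := by
        rw [contDiffOn_nat_iff_continuousOn_differentiableOn_deriv hu]
        refine ⟨fun m hm => ?_, fun m hm => hq.differentiableOn m (by omega)⟩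
        cases m with
        | zero => exact (hq.differentiableOn 0 (by omega)).continuousOn
        | succ j =>
          have := (hq.absolutelyContinuous j (by omega)).continuousOn
          rwa [uIcc_of_le zero_le_one] at this
      refine ⟨fun v => taylorWithinEval q κ (Icc 0 1) v s, ?_, fun v hv => ?_, ?_, ?_⟩
      · exact (continuousOn_taylorWithinEval hu hcd).mono (Icc_subset_Icc_left hs.1.le)
      · have := taylorWithinEval_hasDerivAt_Ioo s zero_lt_one
          (⟨hs.1.trans hv.1, hv.2⟩ : v ∈ Ioo (0 : ℝ) 1) hcd
          (fun t ht => (hq.differentiable_last κ hκ.symm t ht).differentiableWithinAt)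
        simpa [smul_eq_mul, kerDeriv] using this
      · simp
      · simp only [taylor_within_apply]
        refine Finset.sum_eq_zero fun i hi => ?_
        have := hq.deriv_at_one i (by have := Finset.mem_range.mp hi; omega)
        rw [kerDeriv] at this
        rw [this, smul_zero]
  have hsub : uIcc s 1 ⊆ uIcc 0 1 := by
    rw [uIcc_of_le hs.2, uIcc_of_le zero_le_one]; exact Icc_subset_Icc_left hs.1.le
  have hint : IntervalIntegrable (kerTop q (κ + 1)) volume s 1 :=
    (hq.intervalIntegrable_kerTop hκ).mono_set hsub
  have hform : ∀ v, (κ.factorial : ℝ)⁻¹ * (s - v) ^ κ * kerDeriv q (κ + 1) v =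
      -(κ.factorial : ℝ)⁻¹ * ((v - s) ^ κ * kerTop q (κ + 1) v) := fun v => by
    have : (s - v) ^ κ = (-1) ^ κ * (v - s) ^ κ := by rw [← mul_pow]; ring
    rw [this, kerTop, pow_succ]; ring
  have key := intervalIntegral.integral_eq_sub_of_hasDerivAt_of_le hs.2 hFc hFd (by
    simp_rw [hform]
    exact (hint.continuousOn_mul (by fun_prop)).const_mul _)
  simp_rw [hform] at key
  rw [intervalIntegral.integral_const_mul, hFs, hF1] at key
  linarith

theorem continuousOn_Ioc (hq : IsNevanlinnaKernel α q) (hκ : ⌊α⌋₊ = κ + 1) :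
    ContinuousOn q (Ioc (0 : ℝ) 1) := by
  have h0 : kerDeriv q 0 = q := by ext; simp [kerDeriv]
  rcases Nat.eq_zero_or_pos κ with rfl | hpos
  · have := hq.continuousOn_last hκ
    rwa [h0] at this
  · have := (hq.differentiableOn 0 (by omega)).continuousOn
    rw [h0] at this
    exact this.mono Ioc_subset_Icc_self

end IsNevanlinnaKernel

/-! ### Exponential sums of a Nevanlinna kernel -/

/-- The `j`-th derivative in `u` of the summation kernel `∑_{n ≤ w} n q(n / w) sin (n u)`. -/
def kernelSum (q : ℝ → ℝ) (j : ℕ) (w u : ℝ) : ℝ :=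
  ∑ n ∈ Finset.Icc 1 ⌊w⌋₊, (n : ℝ) ^ (j + 1) * q (n / w) * Real.sin (n * u + j * (Real.pi / 2))

/-- The exponential sum `∑_{n ≤ w} n ^ p q(n / w) z ^ n`. -/
def kernelPowerSum (q : ℝ → ℝ) (p : ℕ) (w : ℝ) (z : ℂ) : ℂ :=
  ∑ n ∈ Finset.Icc 1 ⌊w⌋₊, (n : ℂ) ^ p * q (n / w) * z ^ n

theorem kernelSum_eq_im (q : ℝ → ℝ) (j : ℕ) (w u : ℝ) :
    kernelSum q j w u =
      (Complex.I ^ j * kernelPowerSum q (j + 1) w (Complex.exp (Complex.I * u))).im := by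
  rw [kernelSum, kernelPowerSum, Finset.mul_sum, Complex.im_sum]
  refine Finset.sum_congr rfl fun n _ => ?_
  have hI : Complex.I ^ j = Complex.exp ((j * (Real.pi / 2) : ℝ) * Complex.I) := by
    have h := Complex.exp_nat_mul (Real.pi / 2 * Complex.I) j
    rw [Complex.exp_pi_div_two_mul_I] at h
    rw [← h]
    congr 1; push_cast; ring
  have : Complex.I ^ j * ((n : ℂ) ^ (j + 1) * q (n / w) * Complex.exp (Complex.I * u) ^ n) =
      (((n : ℝ) ^ (j + 1) * q (n / w) : ℝ) : ℂ) *
        Complex.exp ((n * u + j * (Real.pi / 2) : ℝ) * Complex.I) := by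
    rw [hI, ← Complex.exp_nat_mul]
    have h2 : Complex.exp ((n * u + j * (Real.pi / 2) : ℝ) * Complex.I) =
        Complex.exp ((j * (Real.pi / 2) : ℝ) * Complex.I) *
          Complex.exp (n * (Complex.I * u)) := by
      rw [← Complex.exp_add]; congr 1; push_cast; ring
    rw [h2]; push_cast; ring
  rw [this, Complex.im_ofReal_mul, Complex.exp_ofReal_mul_I_im]

namespace IsNevanlinnaKernel

variable {α : ℝ} {q : ℝ → ℝ} {κ : ℕ}

theorem intervalIntegrable_kerTop_sub (hq : IsNevanlinnaKernel α q) (hκ : ⌊α⌋₊ = κ + 1) {a b : ℝ}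
    (ha : a ∈ Icc (0 : ℝ) 1) (hb : b ∈ Icc (0 : ℝ) 1) :
    IntervalIntegrable (kerTop q (κ + 1)) volume a b :=
  (hq.intervalIntegrable_kerTop hκ).mono_set (by
    rw [uIcc_of_le zero_le_one]; exact uIcc_subset_Icc ha hb)

theorem ae_kerTop_nonneg (hq : IsNevanlinnaKernel α q) (hκ : ⌊α⌋₊ = κ + 1) {a : ℝ}
    (ha : a ∈ Icc (0 : ℝ) 1) : 0 ≤ᵐ[volume.restrict (Ioc a 1)] kerTop q (κ + 1) := by
  rw [← restrict_Ioo_eq_restrict_Ioc]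
  exact (ae_restrict_iff' measurableSet_Ioo).mpr (Filter.Eventually.of_forall fun y hy =>
    hq.kerTop_nonneg hκ ⟨ha.1.trans_lt hy.1, hy.2⟩)

theorem kerTail_monotoneOn (hq : IsNevanlinnaKernel α q) (hκ : ⌊α⌋₊ = κ + 1) :
    MonotoneOn (kerTail q (κ + 1)) (Icc (0 : ℝ) 1) := by
  intro s hs t ht hst
  have h1 : 1 - t ∈ Icc (0 : ℝ) 1 := ⟨by linarith [ht.2], by linarith [ht.1]⟩
  exact intervalIntegral.integral_mono_interval (by linarith) (by linarith [hs.1]) le_rfl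
    (hq.ae_kerTop_nonneg hκ h1)
    (hq.intervalIntegrable_kerTop_sub hκ h1 ⟨zero_le_one, le_rfl⟩)

theorem kerTail_nonneg (hq : IsNevanlinnaKernel α q) (hκ : ⌊α⌋₊ = κ + 1) {t : ℝ}
    (ht : t ∈ Icc (0 : ℝ) 1) : 0 ≤ kerTail q (κ + 1) t := by
  have h := hq.kerTail_monotoneOn hκ ⟨le_rfl, zero_le_one⟩ ht ht.1
  rwa [kerTail, sub_zero, intervalIntegral.integral_same] at h

theorem mul_kerTop_le_kerTail (hq : IsNevanlinnaKernel α q) (hκ : ⌊α⌋₊ = κ + 1) {t : ℝ}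
    (ht : t ∈ Ioo (0 : ℝ) 1) : t * kerTop q (κ + 1) (1 - t) ≤ kerTail q (κ + 1) t := by
  have h1 : 1 - t ∈ Icc (0 : ℝ) 1 := ⟨by linarith [ht.2], by linarith [ht.1]⟩
  have h := intervalIntegral.integral_mono_on_of_le_Ioo (a := 1 - t) (b := 1)
    (f := fun _ => kerTop q (κ + 1) (1 - t)) (g := kerTop q (κ + 1)) h1.2
    intervalIntegrable_const (hq.intervalIntegrable_kerTop_sub hκ h1 ⟨zero_le_one, le_rfl⟩)
    (fun y hy => hq.kerTop_monotoneOn hκ ⟨by linarith [ht.2], by linarith [ht.1]⟩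
      ⟨h1.1.trans_lt hy.1, hy.2⟩ hy.1.le)
  rw [intervalIntegral.integral_const, smul_eq_mul] at h
  rw [sub_sub_cancel] at h
  exact h

/-- The contribution of the cut-off. On `[0, 1 - δ]` the second mean value estimate is used,
and on `[1 - δ, 1]` the integral `kerTail q (κ + 1) δ` of the weight; `δ` is of the order of
`1 / (w ‖1 - z‖)`. -/
theorem exists_norm_integral_kerTop_mul_rieszOsc_le (hq : IsNevanlinnaKernel α q)
    (hκ : ⌊α⌋₊ = κ + 1) (l i : ℕ) : ∃ C : ℝ, 0 ≤ C ∧ ∀ z : ℂ, ‖z‖ = 1 → z ≠ 1 → ∀ w δ : ℝ,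
      0 < w → δ ∈ Ioc (0 : ℝ) 1 → 1 / (w * δ) ≤ 2 * ‖1 - z‖ →
      ‖∫ v in (0 : ℝ)..1, ((kerTop q (κ + 1) v * (w * v) ^ i : ℝ) : ℂ) * rieszOsc z l (w * v)‖ ≤
        C * (w ^ i / ‖1 - z‖ ^ (l + 1) * kerTail q (κ + 1) δ) := by
  obtain ⟨C₀, hC₀, hb₀⟩ := exists_norm_rieszOsc_le l
  obtain ⟨C₁, hC₁, hb₁⟩ := exists_norm_rieszOsc_le (l + 1)
  refine ⟨4 * C₁ + C₀, by positivity, fun z hz hz1 w δ hw hδ hwδ => ?_⟩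
  have hd : 0 < ‖1 - z‖ := norm_pos_iff.mpr (sub_ne_zero.mpr hz1.symm)
  set d := ‖1 - z‖
  have hδ0 := hδ.1
  have hmem : 1 - δ ∈ Icc (0 : ℝ) 1 := ⟨by linarith [hδ.2], by linarith⟩
  have hQ : 0 ≤ kerTail q (κ + 1) δ := hq.kerTail_nonneg hκ ⟨hδ0.le, hδ.2⟩
  have hEint : ∀ a b : ℝ, 0 ≤ a → 0 ≤ b →
      IntervalIntegrable (fun v => rieszOsc z l (w * v)) volume a b := by
    intro a b ha hb
    have := (intervalIntegrable_rieszOsc hz hz1 l (a := w * a) (b := w * b)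
      (by positivity) (by positivity)).comp_mul_left (c := w)
    rwa [mul_div_cancel_left₀ _ hw.ne', mul_div_cancel_left₀ _ hw.ne'] at this
  have hint : IntervalIntegrable (fun v => ((kerTop q (κ + 1) v * (w * v) ^ i : ℝ) : ℂ) *
      rieszOsc z l (w * v)) volume 0 1 := by
    have h1 : IntervalIntegrable (fun v => kerTop q (κ + 1) v * (w * v) ^ i) volume 0 1 :=
      (hq.intervalIntegrable_kerTop hκ).mul_continuousOn (by fun_prop)
    rw [intervalIntegrable_iff_integrableOn_Ioc_of_le zero_le_one] at h1 ⊢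
    refine h1.ofReal.mul_bdd (c := C₀ / d ^ (l + 1))
      ((measurable_rieszOsc z l).comp (measurable_const_mul w)).aestronglyMeasurable ?_
    exact (ae_restrict_iff' measurableSet_Ioc).mpr (Filter.Eventually.of_forall fun y hy =>
      hb₀ z hz hz1 _ (by have := hy.1; positivity))
  have hsub : ∀ a b : ℝ, a ∈ Icc (0 : ℝ) 1 → b ∈ Icc (0 : ℝ) 1 → IntervalIntegrable (fun v =>
      ((kerTop q (κ + 1) v * (w * v) ^ i : ℝ) : ℂ) * rieszOsc z l (w * v)) volume a b :=
    fun a b ha hb => hint.mono_set (by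
      rw [uIcc_of_le zero_le_one]; exact uIcc_subset_Icc ha hb)
  rw [← intervalIntegral.integral_add_adjacent_intervals
    (hsub 0 (1 - δ) ⟨le_rfl, zero_le_one⟩ hmem) (hsub (1 - δ) 1 hmem ⟨zero_le_one, le_rfl⟩)]
  have hA : ‖∫ v in (0 : ℝ)..(1 - δ), ((kerTop q (κ + 1) v * (w * v) ^ i : ℝ) : ℂ) *
      rieszOsc z l (w * v)‖ ≤ 4 * C₁ * (w ^ i / d ^ (l + 1) * kerTail q (κ + 1) δ) := by
    rcases eq_or_lt_of_le hmem.1 with h0 | h0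
    · rw [← h0, intervalIntegral.integral_same, norm_zero]; positivity
    have hIoo : Ioc (0 : ℝ) (1 - δ) ⊆ Ioo 0 1 := fun y hy => ⟨hy.1, by linarith [hy.2]⟩
    have hprim : ∀ c ∈ Icc (0 : ℝ) (1 - δ),
        ‖∫ v in c..(1 - δ), rieszOsc z l (w * v)‖ ≤ 2 * C₁ / (w * d ^ (l + 2)) := by
      intro c hc
      have h1 := integral_rieszOsc hz hz1 l (a := w * c) (b := w * (1 - δ))
        (mul_nonneg hw.le hc.1) (by gcongr; exact hc.2)
      rw [intervalIntegral.integral_const_mul, ← intervalIntegral.smul_integral_comp_mul_left] at h1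
      have h2 := congrArg norm h1
      rw [norm_mul, norm_smul, Complex.norm_real, Real.norm_eq_abs, Real.norm_eq_abs,
        abs_of_pos hw, abs_of_pos (by positivity : (0 : ℝ) < l + 1)] at h2
      have h3 : ‖rieszOsc z (l + 1) (w * (1 - δ)) - rieszOsc z (l + 1) (w * c)‖ ≤
          2 * C₁ / d ^ (l + 2) := by
        refine (norm_sub_le _ _).trans ?_
        have e1 := hb₁ z hz hz1 (w * (1 - δ)) (by positivity)
        have e2 := hb₁ z hz hz1 (w * c) (mul_nonneg hw.le hc.1)
        have e3 : 2 * C₁ / d ^ (l + 2) = C₁ / d ^ (l + 1 + 1) + C₁ / d ^ (l + 1 + 1) := by ring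
        rw [e3]; exact add_le_add e1 e2
      rw [← h2] at h3
      rw [← div_div, div_right_comm, le_div_iff₀ hw]
      refine le_trans ?_ h3
      rw [mul_comm]
      refine le_mul_of_one_le_left (by positivity) ?_
      linarith [(Nat.cast_nonneg l : (0 : ℝ) ≤ l)]
    have hmono : MonotoneOn (fun v => kerTop q (κ + 1) v * (w * v) ^ i) (Ioc 0 (1 - δ)) := by
      intro x hx y hy hxy
      have := hq.kerTop_nonneg hκ (hIoo hy)
      have := hx.1
      exact mul_le_mul (hq.kerTop_monotoneOn hκ (hIoo hx) (hIoo hy) hxy)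
        (by gcongr) (by positivity) (by assumption)
    have h := norm_integral_mul_le_of_monotoneOn h0 hmono
      (fun y hy => mul_nonneg (hq.kerTop_nonneg hκ (hIoo hy)) (by have := hy.1; positivity))
      (hEint 0 (1 - δ) le_rfl hmem.1) hprim
    refine h.trans ?_
    have hδ1 : δ < 1 := by linarith
    have hk := hq.mul_kerTop_le_kerTail hκ ⟨hδ0, hδ1⟩
    have hk0 := hq.kerTop_nonneg hκ (⟨h0, by linarith⟩ : 1 - δ ∈ Ioo (0 : ℝ) 1)
    have hk' : kerTop q (κ + 1) (1 - δ) ≤ 1 / δ * kerTail q (κ + 1) δ := by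
      rw [one_div, inv_mul_eq_div, le_div_iff₀ hδ0, mul_comm]; exact hk
    calc kerTop q (κ + 1) (1 - δ) * (w * (1 - δ)) ^ i * (2 * C₁ / (w * d ^ (l + 2)))
        ≤ (1 / δ * kerTail q (κ + 1) δ) * w ^ i * (2 * C₁ / (w * d ^ (l + 2))) := by
          gcongr
          nlinarith
      _ = 2 * C₁ * (w ^ i / d ^ (l + 2) * kerTail q (κ + 1) δ) * (1 / (w * δ)) := by
          field_simp
      _ ≤ 2 * C₁ * (w ^ i / d ^ (l + 2) * kerTail q (κ + 1) δ) * (2 * d) := by gcongr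
      _ = 4 * C₁ * (w ^ i / d ^ (l + 1) * kerTail q (κ + 1) δ) := by
          field_simp
          ring
  have hB : ‖∫ v in (1 - δ)..1, ((kerTop q (κ + 1) v * (w * v) ^ i : ℝ) : ℂ) *
      rieszOsc z l (w * v)‖ ≤ C₀ * (w ^ i / d ^ (l + 1) * kerTail q (κ + 1) δ) := by
    have hbd : ∀ᵐ v, v ∈ Ioc (1 - δ) 1 → ‖((kerTop q (κ + 1) v * (w * v) ^ i : ℝ) : ℂ) *
        rieszOsc z l (w * v)‖ ≤ C₀ * w ^ i / d ^ (l + 1) * kerTop q (κ + 1) v := by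
      have h1 := (ae_restrict_iff' measurableSet_Ioc).mp (hq.ae_kerTop_nonneg hκ hmem)
      filter_upwards [h1] with v hv hv1
      have hv2 := hv hv1
      simp only [Pi.zero_apply] at hv2
      have hv0 : 0 < v := hmem.1.trans_lt hv1.1
      rw [norm_mul, Complex.norm_real, Real.norm_eq_abs, abs_of_nonneg (by positivity)]
      calc kerTop q (κ + 1) v * (w * v) ^ i * ‖rieszOsc z l (w * v)‖
          ≤ kerTop q (κ + 1) v * w ^ i * (C₀ / d ^ (l + 1)) := by
            gcongr
            · nlinarith [hv1.2]
            · exact hb₀ z hz hz1 _ (by positivity)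
        _ = C₀ * w ^ i / d ^ (l + 1) * kerTop q (κ + 1) v := by ring
    have h := intervalIntegral.norm_integral_le_of_norm_le hmem.2 hbd
      ((hq.intervalIntegrable_kerTop_sub hκ hmem ⟨zero_le_one, le_rfl⟩).const_mul _)
    rw [intervalIntegral.integral_const_mul] at h
    refine h.trans (le_of_eq ?_)
    rw [kerTail]
    simp only [kerTop]
    ring
  calc _ ≤ _ := norm_add_le _ _
    _ ≤ _ := add_le_add hA hB
    _ = _ := by ring

/-- The exponential sum of the kernel as a mixture of weighted Riesz sums, from the integral
formula for `q`. -/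
theorem kernelPowerSum_eq_integral (hq : IsNevanlinnaKernel α q) (hκ : ⌊α⌋₊ = κ + 1) {p : ℕ}
    (hp : p ≠ 0) {w : ℝ} (hw : 0 < w) (z : ℂ) :
    (κ.factorial * w ^ κ : ℂ) * kernelPowerSum q p w z =
      ∫ v in (0 : ℝ)..1, (kerTop q (κ + 1) v : ℂ) *
        ∑ n ∈ Finset.range (⌊w * v⌋₊ + 1), (n : ℂ) ^ p * ((w * v - n : ℝ) : ℂ) ^ κ * z ^ n := by
  -- the contribution of the index `n` to the sum inside the integral
  set F : ℕ → ℝ → ℂ := fun n => (Ici (n / w : ℝ)).indicator fun v =>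
    (((v * w - n) ^ κ * kerTop q (κ + 1) v : ℝ) : ℂ) * ((n : ℂ) ^ p * z ^ n) with hF
  have hFint : ∀ n, IntegrableOn (F n) (Ioc 0 1) := fun n => by
    refine Integrable.indicator ?_ measurableSet_Ici
    refine Integrable.mul_const ?_ _
    refine Integrable.ofReal ?_
    exact (intervalIntegrable_iff_integrableOn_Ioc_of_le zero_le_one).mp
      ((hq.intervalIntegrable_kerTop hκ).continuousOn_mul (by fun_prop))
  have hterm : ∀ n ∈ Finset.Icc 1 ⌊w⌋₊, (κ.factorial * w ^ κ : ℂ) *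
      ((n : ℂ) ^ p * q (n / w) * z ^ n) = ∫ v in Ioc (0 : ℝ) 1, F n v := by
    intro n hn
    rw [Finset.mem_Icc] at hn
    have hn1 : (1 : ℝ) ≤ n := by exact_mod_cast hn.1
    have hnw : (n : ℝ) ≤ w := (Nat.le_floor_iff hw.le).mp hn.2
    have hs : (n / w : ℝ) ∈ Ioc (0 : ℝ) 1 := ⟨by positivity, (div_le_one hw).mpr hnw⟩
    have h1 : Ici (n / w : ℝ) ∩ Ioc 0 1 = Icc (n / w : ℝ) 1 := by
      ext v
      simp only [mem_inter_iff, mem_Ici, mem_Ioc, mem_Icc]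
      exact ⟨fun h => ⟨h.1, h.2.2⟩, fun h => ⟨h.1, hs.1.trans_le h.1, h.2⟩⟩
    rw [hF, integral_indicator measurableSet_Ici, Measure.restrict_restrict measurableSet_Ici, h1,
      integral_Icc_eq_integral_Ioc, integral_mul_const, integral_complex_ofReal, hq.eq_integral hκ hs,
      ← intervalIntegral.integral_of_le hs.2]
    have h2 : ∀ v : ℝ, (v * w - n) ^ κ * kerTop q (κ + 1) v =
        w ^ κ * ((v - n / w) ^ κ * kerTop q (κ + 1) v) := fun v => by
      rw [← mul_assoc, ← mul_pow]; congr 2; field_simp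
    simp_rw [h2]
    rw [intervalIntegral.integral_const_mul]
    generalize ∫ v in (n / w : ℝ)..1, (v - n / w) ^ κ * kerTop q (κ + 1) v = J
    have : (κ.factorial : ℂ) ≠ 0 := by exact_mod_cast κ.factorial_ne_zero
    push_cast
    field_simp
  rw [kernelPowerSum, Finset.mul_sum, Finset.sum_congr rfl hterm,
    ← integral_finsetSum _ fun n _ => hFint n, intervalIntegral.integral_of_le zero_le_one]
  refine setIntegral_congr_fun measurableSet_Ioc fun v hv => ?_
  have hv0 := hv.1
  rw [Finset.mul_sum]
  have hsub : Finset.Icc 1 ⌊w * v⌋₊ ⊆ Finset.Icc 1 ⌊w⌋₊ :=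
    Finset.Icc_subset_Icc_right (Nat.floor_mono (by nlinarith [hv.2]))
  have hsub2 : Finset.Icc 1 ⌊w * v⌋₊ ⊆ Finset.range (⌊w * v⌋₊ + 1) := fun n hn => by
    rw [Finset.mem_Icc] at hn; rw [Finset.mem_range]; omega
  rw [← Finset.sum_subset hsub, ← Finset.sum_subset hsub2]
  · refine Finset.sum_congr rfl fun n hn => ?_
    rw [Finset.mem_Icc] at hn
    have : (n : ℝ) ≤ w * v := (Nat.le_floor_iff (by positivity)).mp hn.2
    have hmem : v ∈ Ici (n / w : ℝ) := by rw [mem_Ici, div_le_iff₀ hw]; linarith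
    rw [hF]
    simp only [indicator_of_mem hmem]
    push_cast
    ring
  · intro n hn hn'
    have : n = 0 := by
      rw [Finset.mem_range] at hn; rw [Finset.mem_Icc] at hn'; omega
    rw [this]; simp [hp]
  · intro n hn hn'
    rw [Finset.mem_Icc] at hn hn'
    have h1 : ⌊w * v⌋₊ < n := by by_contra h; exact hn' ⟨hn.1, by omega⟩
    have h2 : w * v < n := (Nat.floor_lt (by positivity)).mp h1
    have hmem : v ∉ Ici (n / w : ℝ) := by rw [mem_Ici, div_le_iff₀ hw]; linarith
    rw [hF]
    simp only [indicator_of_notMem hmem]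

end IsNevanlinnaKernel

/-! ### Pointwise kernel estimates -/

theorem half_le_norm_one_sub_exp {u : ℝ} (hu : 0 ≤ u) (huπ : u ≤ Real.pi) :
    u / 2 ≤ ‖1 - Complex.exp (Complex.I * u)‖ := by
  rw [norm_sub_rev, Complex.norm_exp_I_mul_ofReal_sub_one, norm_mul, Real.norm_eq_abs,
    Real.norm_eq_abs, abs_of_pos (by norm_num : (0 : ℝ) < 2)]
  have h := Real.mul_le_sin (x := u / 2) (by linarith) (by linarith)
  have h2 : 1 / 2 ≤ 2 / Real.pi := by
    rw [div_le_div_iff₀ (by norm_num) Real.pi_pos]; linarith [Real.pi_le_four]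
  have h3 : 1 / 2 * (u / 2) ≤ 2 / Real.pi * (u / 2) := by gcongr
  have := le_abs_self (Real.sin (u / 2))
  linarith

namespace IsNevanlinnaKernel

variable {α : ℝ} {q : ℝ → ℝ} {κ : ℕ}

/-- The two contributions to the exponential sum: the first group, a finite sum of Abel moments,
comes from the frequency `0` and the second one, with the oscillating parts, from the cut-off at
`w`. -/
theorem kernelPowerSum_eq (hq : IsNevanlinnaKernel α q) (hκ : ⌊α⌋₊ = κ + 1) {p : ℕ}
    (hp : p ≠ 0) {w : ℝ} (hw : 0 < w) {z : ℂ} (hz : ‖z‖ = 1) (hz1 : z ≠ 1) :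
    (κ.factorial * w ^ κ : ℂ) * kernelPowerSum q p w z =
      ∑ i ∈ Finset.range (κ + 1), (((κ.choose i : ℝ) * (-1) ^ i *
        ∫ v in (0 : ℝ)..1, kerTop q (κ + 1) v * (w * v) ^ (κ - i) : ℝ) : ℂ) *
          abelMoment z (p + i) -
      ∑ i ∈ Finset.range (p + 1), ((p.choose i : ℂ) * (-1) ^ i) *
        ∫ v in (0 : ℝ)..1, ((kerTop q (κ + 1) v * (w * v) ^ (p - i) : ℝ) : ℂ) *
          rieszOsc z (κ + i) (w * v) := by
  have hint : ∀ i : ℕ, IntervalIntegrable (fun v => kerTop q (κ + 1) v * (w * v) ^ i)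
      volume 0 1 := fun i => (hq.intervalIntegrable_kerTop hκ).mul_continuousOn (by fun_prop)
  have hint1 : ∀ i : ℕ, IntegrableOn (fun v => ((kerTop q (κ + 1) v * (w * v) ^ i : ℝ) : ℂ))
      (Ioc 0 1) := fun i =>
    ((intervalIntegrable_iff_integrableOn_Ioc_of_le zero_le_one).mp (hint i)).ofReal
  have hint2 : ∀ i l : ℕ, IntegrableOn (fun v => ((kerTop q (κ + 1) v * (w * v) ^ i : ℝ) : ℂ) *
      rieszOsc z l (w * v)) (Ioc 0 1) := fun i l => by
    obtain ⟨C₀, -, hb₀⟩ := exists_norm_rieszOsc_le l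
    refine (hint1 i).mul_bdd (c := C₀ / ‖1 - z‖ ^ (l + 1))
      ((measurable_rieszOsc z l).comp (measurable_const_mul w)).aestronglyMeasurable ?_
    exact (ae_restrict_iff' measurableSet_Ioc).mpr (Filter.Eventually.of_forall fun y hy =>
      hb₀ z hz hz1 _ (by have := hy.1; positivity))
  rw [hq.kernelPowerSum_eq_integral hκ hp hw]
  have hpt : ∀ v : ℝ, (kerTop q (κ + 1) v : ℂ) *
        ∑ n ∈ Finset.range (⌊w * v⌋₊ + 1), (n : ℂ) ^ p * ((w * v - n : ℝ) : ℂ) ^ κ * z ^ n =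
      ∑ i ∈ Finset.range (κ + 1), ((kerTop q (κ + 1) v * (w * v) ^ (κ - i) : ℝ) : ℂ) *
        ((κ.choose i : ℂ) * (-1) ^ i * abelMoment z (p + i)) -
      ∑ i ∈ Finset.range (p + 1), ((p.choose i : ℂ) * (-1) ^ i) *
        (((kerTop q (κ + 1) v * (w * v) ^ (p - i) : ℝ) : ℂ) *
          rieszOsc z (κ + i) (w * v)) := by
    intro v
    rw [sum_pow_mul_sub_pow, mul_sub, Finset.mul_sum, Finset.mul_sum]
    congr 1
    · exact Finset.sum_congr rfl fun i _ => by push_cast; ring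
    · exact Finset.sum_congr rfl fun i _ => by push_cast; ring
  simp_rw [hpt]
  simp only [intervalIntegral.integral_of_le (zero_le_one (α := ℝ))]
  rw [integral_sub (integrable_finsetSum _ fun i _ => (hint1 _).mul_const _)
    (integrable_finsetSum _ fun i _ => (hint2 _ _).const_mul _),
    integral_finsetSum _ (fun i _ => (hint1 _).mul_const _),
    integral_finsetSum _ (fun i _ => (hint2 _ _).const_mul _)]
  congr 1
  · refine Finset.sum_congr rfl fun i _ => ?_
    rw [integral_mul_const, integral_complex_ofReal]
    push_cast
    ring
  · refine Finset.sum_congr rfl fun i _ => ?_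
    rw [integral_const_mul]

/-- The main kernel estimate, away from the origin. The first term is the contribution of the
cut-off, the second one that of the frequency `0`. -/
theorem exists_abs_kernelSum_le (hq : IsNevanlinnaKernel α q) (hκ : ⌊α⌋₊ = κ + 1) (j : ℕ) :
    ∃ C : ℝ, 0 ≤ C ∧ ∀ w u : ℝ, 0 < w → 0 < u → u ≤ Real.pi → 1 ≤ w * u →
      |kernelSum q j w u| ≤ C * (w ^ (j + 1) / (w ^ κ * u ^ (κ + 1)) *
        kerTail q (κ + 1) (1 / (w * u)) + 1 / (w * u ^ (j + 3))) := by
  choose CA hCA0 hCA using exists_norm_abelMoment_le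
  choose CE hCE0 hCE using hq.exists_norm_integral_kerTop_mul_rieszOsc_le hκ
  set Q₁ := kerTail q (κ + 1) 1 with hQ₁
  have hQ₁0 : 0 ≤ Q₁ := hq.kerTail_nonneg hκ ⟨zero_le_one, le_rfl⟩
  set K₁ : ℝ := ∑ i ∈ Finset.range κ, (κ.choose (i + 1) : ℝ) * Q₁ *
    (CA (j + 1 + (i + 1)) * 2 ^ (j + 1 + (i + 1) + 1)) with hK₁
  set K₂ : ℝ := ∑ i ∈ Finset.range (j + 1 + 1), ((j + 1).choose i : ℝ) *
    (CE (κ + i) (j + 1 - i) * 2 ^ (κ + i + 1)) with hK₂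
  have hK₁0 : 0 ≤ K₁ := Finset.sum_nonneg fun i _ => by have := hCA0 (j + 1 + (i + 1)); positivity
  have hK₂0 : 0 ≤ K₂ :=
    Finset.sum_nonneg fun i _ => by have := hCE0 (κ + i) (j + 1 - i); positivity
  refine ⟨K₁ + K₂, by positivity, fun w u hw hu huπ hwu => ?_⟩
  set z : ℂ := Complex.exp (Complex.I * u) with hzdef
  have hz : ‖z‖ = 1 := by rw [hzdef, mul_comm]; exact Complex.norm_exp_ofReal_mul_I u
  have hdu : u / 2 ≤ ‖1 - z‖ := half_le_norm_one_sub_exp hu.le huπ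
  have hd : 0 < ‖1 - z‖ := by linarith
  have hz1 : z ≠ 1 := fun h => by rw [h, sub_self, norm_zero] at hd; exact lt_irrefl _ hd
  set δ := 1 / (w * u) with hδdef
  have hwu0 : 0 < w * u := by positivity
  have hδ : δ ∈ Ioc (0 : ℝ) 1 := ⟨by positivity, by rw [hδdef, div_le_one hwu0]; exact hwu⟩
  have hQδ : 0 ≤ kerTail q (κ + 1) δ := hq.kerTail_nonneg hκ ⟨hδ.1.le, hδ.2⟩
  have hdpow : ∀ n : ℕ, 1 / ‖1 - z‖ ^ n ≤ 2 ^ n / u ^ n := by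
    intro n
    rw [div_le_div_iff₀ (by positivity) (by positivity), one_mul, ← mul_pow]
    gcongr
    linarith
  have hwδ : 1 / (w * δ) ≤ 2 * ‖1 - z‖ := by
    have : 1 / (w * δ) = u := by rw [hδdef]; field_simp
    rw [this]; linarith
  have hsplit := hq.kernelPowerSum_eq hκ (Nat.succ_ne_zero j) hw hz hz1
  set c : ℝ := κ.factorial * w ^ κ with hc
  have hc1 : w ^ κ ≤ c := by
    rw [hc]
    exact le_mul_of_one_le_left (by positivity) (by exact_mod_cast κ.factorial_pos)
  have hckernel : c * kernelSum q j w u =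
      (Complex.I ^ j * ((κ.factorial * w ^ κ : ℂ) * kernelPowerSum q (j + 1) w z)).im := by
    have : Complex.I ^ j * ((κ.factorial * w ^ κ : ℂ) * kernelPowerSum q (j + 1) w z) =
        (c : ℂ) * (Complex.I ^ j * kernelPowerSum q (j + 1) w z) := by
      rw [hc]; push_cast; ring
    rw [this, Complex.im_ofReal_mul, kernelSum_eq_im]
  rw [hsplit, mul_sub, Complex.sub_im] at hckernel
  have hM : ∀ i : ℕ, |∫ v in (0 : ℝ)..1, kerTop q (κ + 1) v * (w * v) ^ i| ≤ w ^ i * Q₁ := by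
    intro i
    have h1 : ∀ᵐ v, v ∈ Ioc (0 : ℝ) 1 → ‖kerTop q (κ + 1) v * (w * v) ^ i‖ ≤
        w ^ i * kerTop q (κ + 1) v := by
      have h0 := (ae_restrict_iff' measurableSet_Ioc).mp
        (hq.ae_kerTop_nonneg hκ ⟨le_rfl, zero_le_one⟩)
      filter_upwards [h0] with v hv hv1
      have hv2 := hv hv1
      simp only [Pi.zero_apply] at hv2
      have hv0 := hv1.1
      rw [Real.norm_eq_abs, abs_of_nonneg (by positivity), mul_comm]
      gcongr
      nlinarith [hv1.2]
    have h := intervalIntegral.norm_integral_le_of_norm_le zero_le_one h1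
      ((hq.intervalIntegrable_kerTop hκ).const_mul _)
    rw [intervalIntegral.integral_const_mul, Real.norm_eq_abs] at h
    rw [hQ₁, kerTail, sub_self]
    exact h
  have hA : |(Complex.I ^ j * ∑ i ∈ Finset.range (κ + 1), (((κ.choose i : ℝ) * (-1) ^ i *
        ∫ v in (0 : ℝ)..1, kerTop q (κ + 1) v * (w * v) ^ (κ - i) : ℝ) : ℂ) *
          abelMoment z (j + 1 + i)).im| ≤ K₁ * (w ^ κ * (1 / (w * u ^ (j + 3)))) := by
    -- the term `i = 0` would be of order `w ^ κ * u ^ (-2 - j)`; it has no imaginary part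
    rw [Finset.mul_sum, Complex.im_sum, Finset.sum_range_succ']
    have h0 : (Complex.I ^ j * ((((κ.choose 0 : ℝ) * (-1) ^ 0 *
        ∫ v in (0 : ℝ)..1, kerTop q (κ + 1) v * (w * v) ^ (κ - 0) : ℝ) : ℂ) *
          abelMoment z (j + 1 + 0))).im = 0 := by
      rw [mul_left_comm, Complex.im_ofReal_mul, add_zero, im_I_pow_mul_abelMoment hz hz1, mul_zero]
    rw [h0, add_zero, hK₁, Finset.sum_mul]
    refine (Finset.abs_sum_le_sum_abs _ _).trans (Finset.sum_le_sum fun i hi => ?_)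
    have hi' : i + 1 ≤ κ := Finset.mem_range.mp hi
    refine (Complex.abs_im_le_norm _).trans ?_
    rw [norm_mul, norm_pow, Complex.norm_I, one_pow, one_mul, norm_mul, Complex.norm_real,
      Real.norm_eq_abs, abs_mul, abs_mul, abs_pow, abs_neg, abs_one, one_pow, mul_one, Nat.abs_cast]
    have e1 := hM (κ - (i + 1))
    have e2 : ‖abelMoment z (j + 1 + (i + 1))‖ ≤ CA (j + 1 + (i + 1)) *
        (2 ^ (j + 1 + (i + 1) + 1) / u ^ (j + 1 + (i + 1) + 1)) := by
      refine (hCA _ z hz hz1).trans ?_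
      rw [div_eq_mul_one_div]
      exact mul_le_mul_of_nonneg_left (hdpow _) (hCA0 _)
    have hC := hCA0 (j + 1 + (i + 1))
    have e3 : w ^ (κ - (i + 1)) / u ^ (j + 1 + (i + 1) + 1) ≤ w ^ κ * (1 / (w * u ^ (j + 3))) := by
      have : w ^ κ = w ^ (κ - (i + 1)) * w ^ (i + 1) := by rw [← pow_add]; congr 1; omega
      rw [this, mul_one_div, div_le_div_iff₀ (by positivity) (by positivity)]
      have h1 : 1 ≤ (w * u) ^ i := one_le_pow₀ hwu
      calc w ^ (κ - (i + 1)) * (w * u ^ (j + 3))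
          ≤ w ^ (κ - (i + 1)) * (w * u ^ (j + 3)) * (w * u) ^ i :=
            le_mul_of_one_le_right (by positivity) h1
        _ = w ^ (κ - (i + 1)) * w ^ (i + 1) * u ^ (j + 1 + (i + 1) + 1) := by ring
    calc (κ.choose (i + 1) : ℝ) * |∫ v in (0 : ℝ)..1, kerTop q (κ + 1) v * (w * v) ^ (κ - (i + 1))|
          * ‖abelMoment z (j + 1 + (i + 1))‖
        ≤ (κ.choose (i + 1) : ℝ) * (w ^ (κ - (i + 1)) * Q₁) * (CA (j + 1 + (i + 1)) *
        (2 ^ (j + 1 + (i + 1) + 1) / u ^ (j + 1 + (i + 1) + 1))) := by gcongr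
      _ = (κ.choose (i + 1) : ℝ) * Q₁ * (CA (j + 1 + (i + 1)) * 2 ^ (j + 1 + (i + 1) + 1)) *
          (w ^ (κ - (i + 1)) / u ^ (j + 1 + (i + 1) + 1)) := by ring
      _ ≤ _ := by gcongr
  have hB : |(Complex.I ^ j * ∑ i ∈ Finset.range (j + 1 + 1), (((j + 1).choose i : ℂ) * (-1) ^ i) *
        ∫ v in (0 : ℝ)..1, ((kerTop q (κ + 1) v * (w * v) ^ (j + 1 - i) : ℝ) : ℂ) *
          rieszOsc z (κ + i) (w * v)).im| ≤
      K₂ * (w ^ κ * (w ^ (j + 1) / (w ^ κ * u ^ (κ + 1)) * kerTail q (κ + 1) δ)) := by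
    refine (Complex.abs_im_le_norm _).trans ?_
    rw [norm_mul, norm_pow, Complex.norm_I, one_pow, one_mul, hK₂, Finset.sum_mul]
    refine (norm_sum_le _ _).trans (Finset.sum_le_sum fun i hi => ?_)
    have hi' : i ≤ j + 1 := Nat.lt_succ_iff.mp (Finset.mem_range.mp hi)
    rw [norm_mul, norm_mul, norm_pow, norm_neg, norm_one, one_pow, mul_one, Complex.norm_natCast]
    have e1 := hCE (κ + i) (j + 1 - i) z hz hz1 w δ hw hδ hwδ
    have hC := hCE0 (κ + i) (j + 1 - i)
    have e2 : w ^ (j + 1 - i) / ‖1 - z‖ ^ (κ + i + 1) ≤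
        2 ^ (κ + i + 1) * (w ^ κ * (w ^ (j + 1) / (w ^ κ * u ^ (κ + 1)))) := by
      have h1 : 1 ≤ (w * u) ^ i := one_le_pow₀ hwu
      have h2 : w ^ (j + 1) = w ^ (j + 1 - i) * w ^ i := by rw [← pow_add]; congr 1; omega
      calc w ^ (j + 1 - i) / ‖1 - z‖ ^ (κ + i + 1)
          = w ^ (j + 1 - i) * (1 / ‖1 - z‖ ^ (κ + i + 1)) := by ring
        _ ≤ w ^ (j + 1 - i) * (2 ^ (κ + i + 1) / u ^ (κ + i + 1)) :=
            mul_le_mul_of_nonneg_left (hdpow _) (by positivity)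
        _ ≤ w ^ (j + 1 - i) * (2 ^ (κ + i + 1) / u ^ (κ + i + 1)) * (w * u) ^ i :=
            le_mul_of_one_le_right (by positivity) h1
        _ = 2 ^ (κ + i + 1) * (w ^ κ * (w ^ (j + 1) / (w ^ κ * u ^ (κ + 1)))) := by
            rw [h2]; field_simp; ring
    calc ((j + 1).choose i : ℝ) * _
        ≤ ((j + 1).choose i : ℝ) * (CE (κ + i) (j + 1 - i) *
          (w ^ (j + 1 - i) / ‖1 - z‖ ^ (κ + i + 1) * kerTail q (κ + 1) δ)) := by gcongr
      _ ≤ ((j + 1).choose i : ℝ) * (CE (κ + i) (j + 1 - i) *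
          (2 ^ (κ + i + 1) * (w ^ κ * (w ^ (j + 1) / (w ^ κ * u ^ (κ + 1)))) *
            kerTail q (κ + 1) δ)) := by gcongr
      _ = _ := by ring
  have hfin : w ^ κ * |kernelSum q j w u| ≤ w ^ κ * ((K₁ + K₂) *
      (w ^ (j + 1) / (w ^ κ * u ^ (κ + 1)) * kerTail q (κ + 1) δ + 1 / (w * u ^ (j + 3)))) := by
    calc w ^ κ * |kernelSum q j w u| ≤ c * |kernelSum q j w u| := by gcongr
      _ = |c * kernelSum q j w u| := by
          rw [abs_mul, abs_of_pos (lt_of_lt_of_le (by positivity) hc1)]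
      _ ≤ _ := by rw [hckernel]; exact abs_sub _ _
      _ ≤ _ := add_le_add hA hB
      _ ≤ _ := by
          have a1 : 0 ≤ K₂ * (w ^ κ * (1 / (w * u ^ (j + 3)))) := by positivity
          have a2 : 0 ≤ K₁ * (w ^ κ * (w ^ (j + 1) / (w ^ κ * u ^ (κ + 1)) *
            kerTail q (κ + 1) δ)) := by positivity
          linarith
  exact le_of_mul_le_mul_left hfin (by positivity)

theorem exists_le_of_mem_Ioc (hq : IsNevanlinnaKernel α q) (hκ : ⌊α⌋₊ = κ + 1) :
    ∃ C : ℝ, 0 ≤ C ∧ ∀ s ∈ Ioc (0 : ℝ) 1, |q s| ≤ C := by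
  refine ⟨(κ.factorial : ℝ)⁻¹ * kerTail q (κ + 1) 1, mul_nonneg (by positivity)
    (hq.kerTail_nonneg hκ ⟨zero_le_one, le_rfl⟩), fun s hs => ?_⟩
  rw [abs_of_nonneg (hq.nonneg s ⟨hs.1.le, hs.2⟩), hq.eq_integral hκ hs]
  gcongr
  have hs' : s ∈ Icc (0 : ℝ) 1 := ⟨hs.1.le, hs.2⟩
  have h1 : IntervalIntegrable (kerTop q (κ + 1)) volume s 1 :=
    hq.intervalIntegrable_kerTop_sub hκ hs' ⟨zero_le_one, le_rfl⟩
  calc ∫ v in s..1, (v - s) ^ κ * kerTop q (κ + 1) v ≤ ∫ v in s..1, kerTop q (κ + 1) v := by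
        refine intervalIntegral.integral_mono_on_of_le_Ioo hs.2
          (h1.continuousOn_mul (by fun_prop)) h1 fun v hv => ?_
        refine mul_le_of_le_one_left (hq.kerTop_nonneg hκ ⟨hs.1.trans hv.1, hv.2⟩) ?_
        exact pow_le_one₀ (by linarith [hv.1]) (by linarith [hv.2, hs.1])
    _ = kerTail q (κ + 1) (1 - s) := by rw [kerTail, sub_sub_cancel]; rfl
    _ ≤ _ := hq.kerTail_monotoneOn hκ ⟨by linarith [hs.2], by linarith [hs.1]⟩
        ⟨zero_le_one, le_rfl⟩ (by linarith [hs.1])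

/-- The trivial estimate of the kernel, used for `w * u ≤ 1`. -/
theorem exists_abs_kernelSum_le_pow (hq : IsNevanlinnaKernel α q) (hκ : ⌊α⌋₊ = κ + 1) (j : ℕ) :
    ∃ C : ℝ, 0 ≤ C ∧ ∀ w u : ℝ, 0 < w → |kernelSum q j w u| ≤ C * w ^ (j + 2) := by
  obtain ⟨C, hC0, hC⟩ := hq.exists_le_of_mem_Ioc hκ
  refine ⟨C, hC0, fun w u hw => ?_⟩
  have hterm : ∀ n ∈ Finset.Icc 1 ⌊w⌋₊, |(n : ℝ) ^ (j + 1) * q (n / w) *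
      Real.sin (n * u + j * (Real.pi / 2))| ≤ w ^ (j + 1) * C := by
    intro n hn
    rw [Finset.mem_Icc] at hn
    have hn1 : (1 : ℝ) ≤ n := by exact_mod_cast hn.1
    have hnw : (n : ℝ) ≤ w := (Nat.le_floor_iff hw.le).mp hn.2
    rw [abs_mul, abs_mul, abs_pow, Nat.abs_cast]
    calc (n : ℝ) ^ (j + 1) * |q (n / w)| * |Real.sin (n * u + j * (Real.pi / 2))|
        ≤ w ^ (j + 1) * C * 1 := by
          gcongr
          · exact hC _ ⟨by positivity, (div_le_one hw).mpr hnw⟩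
          · exact Real.abs_sin_le_one _
      _ = _ := mul_one _
  calc |kernelSum q j w u| ≤ ∑ n ∈ Finset.Icc 1 ⌊w⌋₊, w ^ (j + 1) * C :=
        (Finset.abs_sum_le_sum_abs _ _).trans (Finset.sum_le_sum hterm)
    _ = ⌊w⌋₊ * (w ^ (j + 1) * C) := by simp
    _ ≤ w * (w ^ (j + 1) * C) := by gcongr; exact Nat.floor_le hw.le
    _ = C * w ^ (j + 2) := by ring

end IsNevanlinnaKernel

/-! ### The weighted kernel and interpolation of fractional derivatives -/

theorem hasDerivAt_kernelSum (q : ℝ → ℝ) (j : ℕ) (w u : ℝ) :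
    HasDerivAt (kernelSum q j w) (kernelSum q (j + 1) w u) u := by
  have h : ∀ n ∈ Finset.Icc 1 ⌊w⌋₊, HasDerivAt (fun u : ℝ => (n : ℝ) ^ (j + 1) * q (n / w) *
      Real.sin (n * u + j * (Real.pi / 2))) ((n : ℝ) ^ (j + 1 + 1) * q (n / w) *
      Real.sin (n * u + (j + 1 : ℕ) * (Real.pi / 2))) u := by
    intro n _
    have h1 : HasDerivAt (fun u : ℝ => n * u + j * (Real.pi / 2)) (n : ℝ) u := by
      simpa using ((hasDerivAt_id u).const_mul (n : ℝ)).add_const (j * (Real.pi / 2))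
    refine (h1.sin.const_mul _).congr_deriv ?_
    have : (n : ℝ) * u + (j + 1 : ℕ) * (Real.pi / 2) = n * u + j * (Real.pi / 2) + Real.pi / 2 := by
      push_cast; ring
    rw [this, Real.sin_add_pi_div_two]; ring
  exact HasDerivAt.fun_sum h

theorem contDiff_kernelSum (q : ℝ → ℝ) (j : ℕ) (w : ℝ) {n : WithTop ℕ∞} :
    ContDiff ℝ n (kernelSum q j w) := by
  unfold kernelSum
  fun_prop

theorem iteratedDeriv_kernelSum (q : ℝ → ℝ) (j i : ℕ) (w : ℝ) :
    iteratedDeriv i (kernelSum q j w) = kernelSum q (j + i) w := by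
  induction i with
  | zero => simp
  | succ i ih =>
    rw [iteratedDeriv_succ, ih]
    ext u
    exact (hasDerivAt_kernelSum q (j + i) w u).deriv

/-- The factor `u ^ r` times the `r`-th derivative of the summation kernel: the kernel against
which `h` is integrated. -/
def weightedKernel (q : ℝ → ℝ) (r : ℕ) (w u : ℝ) : ℝ := u ^ r * kernelSum q r w u

theorem contDiff_weightedKernel (q : ℝ → ℝ) (r : ℕ) (w : ℝ) {n : WithTop ℕ∞} :
    ContDiff ℝ n (weightedKernel q r w) :=
  (contDiff_id.pow r).mul (contDiff_kernelSum q r w)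

theorem iteratedDeriv_weightedKernel (q : ℝ → ℝ) (r i : ℕ) (w u : ℝ) :
    iteratedDeriv i (weightedKernel q r w) u = ∑ l ∈ Finset.range (i + 1),
      (i.choose l : ℝ) * (r.descFactorial l * u ^ (r - l)) * kernelSum q (r + (i - l)) w u := by
  have h := iteratedDeriv_fun_mul (n := i) (x := u) (f := fun u : ℝ => u ^ r)
    (g := kernelSum q r w) (by fun_prop) (contDiff_kernelSum q r w).contDiffAt
  have h2 : weightedKernel q r w = fun u => u ^ r * kernelSum q r w u := rfl
  rw [h2, h]
  refine Finset.sum_congr rfl fun l _ => ?_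
  rw [iteratedDeriv_kernelSum, iteratedDeriv_pow]

namespace IsNevanlinnaKernel

variable {α : ℝ} {q : ℝ → ℝ} {κ : ℕ}

theorem exists_abs_iteratedDeriv_weightedKernel_le_pow (hq : IsNevanlinnaKernel α q)
    (hκ : ⌊α⌋₊ = κ + 1) (r i : ℕ) : ∃ C : ℝ, 0 ≤ C ∧ ∀ w u : ℝ, 0 < w → 0 < u → w * u ≤ 1 →
      |iteratedDeriv i (weightedKernel q r w) u| ≤ C * w ^ (i + 2) := by
  choose C hC0 hC using hq.exists_abs_kernelSum_le_pow hκ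
  refine ⟨∑ l ∈ Finset.range (i + 1), (i.choose l : ℝ) * r.descFactorial l * C (r + (i - l)),
    Finset.sum_nonneg fun l _ => by have := hC0 (r + (i - l)); positivity,
    fun w u hw hu hwu => ?_⟩
  rw [iteratedDeriv_weightedKernel, Finset.sum_mul]
  refine (Finset.abs_sum_le_sum_abs _ _).trans (Finset.sum_le_sum fun l hl => ?_)
  have hl' : l ≤ i := Nat.lt_succ_iff.mp (Finset.mem_range.mp hl)
  rcases lt_or_ge r l with hrl | hrl
  · have := hC0 (r + (i - l))
    rw [Nat.descFactorial_of_lt hrl]; simp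
  have hC' := hC0 (r + (i - l))
  rw [abs_mul, abs_of_nonneg (by positivity)]
  have h1 : u ^ (r - l) * w ^ (r + (i - l) + 2) ≤ w ^ (i + 2) := by
    have : w ^ (r + (i - l) + 2) = w ^ (r - l) * w ^ (i + 2) := by rw [← pow_add]; congr 1; omega
    rw [this, ← mul_assoc, ← mul_pow]
    exact mul_le_of_le_one_left (by positivity) (pow_le_one₀ (by positivity) (by linarith))
  calc (i.choose l : ℝ) * (r.descFactorial l * u ^ (r - l)) * |kernelSum q (r + (i - l)) w u|
      ≤ (i.choose l : ℝ) * (r.descFactorial l * u ^ (r - l)) *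
        (C (r + (i - l)) * w ^ (r + (i - l) + 2)) := by gcongr; exact hC _ w u hw
    _ = (i.choose l : ℝ) * r.descFactorial l * C (r + (i - l)) *
        (u ^ (r - l) * w ^ (r + (i - l) + 2)) := by ring
    _ ≤ _ := by gcongr

theorem exists_abs_iteratedDeriv_weightedKernel_le (hq : IsNevanlinnaKernel α q)
    (hκ : ⌊α⌋₊ = κ + 1) {r m : ℕ} (hm : κ = r + m) (i : ℕ) : ∃ C : ℝ, 0 ≤ C ∧
      ∀ w u : ℝ, 0 < w → 0 < u → u ≤ Real.pi → 1 ≤ w * u →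
      |iteratedDeriv i (weightedKernel q r w) u| ≤ C * (w ^ (i + 1) / (w ^ m * u ^ (m + 1)) *
        kerTail q (κ + 1) (1 / (w * u)) + 1 / (w * u ^ (i + 3))) := by
  choose C hC0 hC using hq.exists_abs_kernelSum_le hκ
  refine ⟨∑ l ∈ Finset.range (i + 1), (i.choose l : ℝ) * r.descFactorial l * C (r + (i - l)),
    Finset.sum_nonneg fun l _ => by have := hC0 (r + (i - l)); positivity,
    fun w u hw hu huπ hwu => ?_⟩
  have hwu0 : 0 < w * u := by positivity
  have hQ : 0 ≤ kerTail q (κ + 1) (1 / (w * u)) :=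
    hq.kerTail_nonneg hκ ⟨by positivity, by rw [div_le_one hwu0]; exact hwu⟩
  set Q := kerTail q (κ + 1) (1 / (w * u))
  rw [iteratedDeriv_weightedKernel, Finset.sum_mul]
  refine (Finset.abs_sum_le_sum_abs _ _).trans (Finset.sum_le_sum fun l hl => ?_)
  have hl' : l ≤ i := Nat.lt_succ_iff.mp (Finset.mem_range.mp hl)
  rcases lt_or_ge r l with hrl | hrl
  · rw [Nat.descFactorial_of_lt hrl]; simp
  have hC' := hC0 (r + (i - l))
  rw [abs_mul, abs_of_nonneg (by positivity)]
  have h1 : u ^ (r - l) * (w ^ (r + (i - l) + 1) / (w ^ κ * u ^ (κ + 1))) ≤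
      w ^ (i + 1) / (w ^ m * u ^ (m + 1)) := by
    have e1 : w ^ (r + (i - l) + 1) * w ^ l = w ^ r * w ^ (i + 1) := by
      rw [← pow_add, ← pow_add]; congr 1; omega
    have e2 : u ^ (r - l) * u ^ l = u ^ r := by rw [← pow_add]; congr 1; omega
    have h2 : 1 ≤ (w * u) ^ l := one_le_pow₀ hwu
    calc u ^ (r - l) * (w ^ (r + (i - l) + 1) / (w ^ κ * u ^ (κ + 1)))
        ≤ u ^ (r - l) * (w ^ (r + (i - l) + 1) / (w ^ κ * u ^ (κ + 1))) * (w * u) ^ l :=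
          le_mul_of_one_le_right (by positivity) h2
      _ = (u ^ (r - l) * u ^ l) * (w ^ (r + (i - l) + 1) * w ^ l) / (w ^ κ * u ^ (κ + 1)) := by
          rw [mul_pow]; ring
      _ = w ^ (i + 1) / (w ^ m * u ^ (m + 1)) := by
          rw [e1, e2, hm]; field_simp; ring
  have h3 : u ^ (r - l) * (1 / (w * u ^ (r + (i - l) + 3))) = 1 / (w * u ^ (i + 3)) := by
    have : u ^ (r + (i - l) + 3) = u ^ (r - l) * u ^ (i + 3) := by rw [← pow_add]; congr 1; omega
    rw [this]; field_simp
  calc (i.choose l : ℝ) * (r.descFactorial l * u ^ (r - l)) * |kernelSum q (r + (i - l)) w u|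
      ≤ (i.choose l : ℝ) * (r.descFactorial l * u ^ (r - l)) *
        (C (r + (i - l)) * (w ^ (r + (i - l) + 1) / (w ^ κ * u ^ (κ + 1)) * Q +
          1 / (w * u ^ (r + (i - l) + 3)))) := by gcongr; exact hC _ w u hw hu huπ hwu
    _ = (i.choose l : ℝ) * r.descFactorial l * C (r + (i - l)) *
        (u ^ (r - l) * (w ^ (r + (i - l) + 1) / (w ^ κ * u ^ (κ + 1))) * Q +
          u ^ (r - l) * (1 / (w * u ^ (r + (i - l) + 3)))) := by ring
    _ ≤ _ := by rw [h3]; gcongr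

end IsNevanlinnaKernel

theorem intervalIntegrable_sub_rpow {p : ℝ} (hp : -1 < p) (t c d : ℝ) :
    IntervalIntegrable (fun s => (s - t) ^ p) volume c d := by
  have := (intervalIntegral.intervalIntegrable_rpow' (r := p) (a := c - t) (b := d - t)
    hp).comp_sub_right t
  simpa using this

theorem abs_integral_rpow_mul_le {g : ℝ → ℝ} {σ t b M : ℝ} (hσ1 : σ < 1) (htb : t ≤ b)
    (hM : ∀ s ∈ Ioc t b, |g s| ≤ M) :
    |∫ s in t..b, (s - t) ^ (-σ) * g s| ≤ M * ((b - t) ^ (1 - σ) / (1 - σ)) := by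
  have h1 : ∀ᵐ s, s ∈ Ioc t b → ‖(s - t) ^ (-σ) * g s‖ ≤ M * (s - t) ^ (-σ) := by
    refine Filter.Eventually.of_forall fun s hs => ?_
    have : 0 ≤ (s - t) ^ (-σ) := Real.rpow_nonneg (by linarith [hs.1]) _
    rw [Real.norm_eq_abs, abs_mul, abs_of_nonneg this, mul_comm]
    gcongr
    exact hM s hs
  have h2 := intervalIntegral.norm_integral_le_of_norm_le htb h1
    ((intervalIntegrable_sub_rpow (by linarith) t t b).const_mul _)
  rw [intervalIntegral.integral_const_mul,
    intervalIntegral.integral_comp_sub_right (fun x => x ^ (-σ)), sub_self,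
    integral_rpow (Or.inl (by linarith)), Real.zero_rpow (by linarith), sub_zero] at h2
  have e : -σ + 1 = 1 - σ := by ring
  rwa [e, Real.norm_eq_abs] at h2

/-- Interpolation: a fractional derivative of order `σ` is bounded through sup norms of the
function and of its derivative, by cutting the integral at distance `h` from the singularity. -/
theorem abs_integral_rpow_mul_deriv_le {g g' : ℝ → ℝ} {σ t b A B h : ℝ} (hσ0 : 0 ≤ σ)
    (hσ1 : σ < 1) (htb : t < b) (hh : 0 < h) (hg : ∀ s, HasDerivAt g (g' s) s)
    (hg' : Continuous g') (hA : ∀ s ∈ Ioc t b, |g s| ≤ A) (hB : ∀ s ∈ Ioc t b, |g' s| ≤ B) :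
    |∫ s in t..b, (s - t) ^ (-σ) * g' s| ≤ B * (h ^ (1 - σ) / (1 - σ)) + 2 * A * h ^ (-σ) := by
  have hA0 : 0 ≤ A := (abs_nonneg _).trans (hA b ⟨htb, le_rfl⟩)
  have hB0 : 0 ≤ B := (abs_nonneg _).trans (hB b ⟨htb, le_rfl⟩)
  have hint' : ∀ c d : ℝ, IntervalIntegrable (fun s => (s - t) ^ (-σ) * g' s) volume c d :=
    fun c d => (intervalIntegrable_sub_rpow (by linarith) t c d).mul_continuousOn hg'.continuousOn
  have hnear : ∀ c, t ≤ c → c ≤ b → c ≤ t + h →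
      |∫ s in t..c, (s - t) ^ (-σ) * g' s| ≤ B * (h ^ (1 - σ) / (1 - σ)) := by
    intro c htc hcb hch
    refine (abs_integral_rpow_mul_le hσ1 htc fun s hs => hB s ⟨hs.1, hs.2.trans hcb⟩).trans ?_
    have : 0 < 1 - σ := by linarith
    gcongr
    linarith
  rcases le_or_gt b (t + h) with hbh | hbh
  · have := hnear b htb.le le_rfl hbh
    have : 0 ≤ 2 * A * h ^ (-σ) := by positivity
    linarith
  · rw [← intervalIntegral.integral_add_adjacent_intervals (hint' t (t + h)) (hint' (t + h) b)]
    refine (abs_add_le _ _).trans (add_le_add (hnear _ (by linarith) hbh.le le_rfl) ?_)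
    -- the reflection `y = -s` turns the decreasing weight into an increasing one
    have h1 := norm_integral_mul_le_of_monotoneOn (g := fun y => (-y - t) ^ (-σ))
      (E := fun y => (g' (-y) : ℂ)) (a := -b) (b := -(t + h)) (M := 2 * A) (by linarith) ?_ ?_ ?_ ?_
    · rw [neg_neg, add_sub_cancel_left] at h1
      have h2 : ∫ y in (-b)..(-(t + h)), ((((-y - t) ^ (-σ) : ℝ)) : ℂ) * (g' (-y) : ℂ) =
          ((∫ s in (t + h)..b, (s - t) ^ (-σ) * g' s : ℝ) : ℂ) := by
        have h3 := intervalIntegral.integral_comp_neg (a := -b) (b := -(t + h))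
          (fun s => (s - t) ^ (-σ) * g' s)
        rw [neg_neg, neg_neg] at h3
        rw [← h3, ← intervalIntegral.integral_ofReal]
        simp only [Complex.ofReal_mul]
      rw [h2, Complex.norm_real, Real.norm_eq_abs] at h1
      linarith
    · intro x hx y hy hxy
      exact Real.rpow_le_rpow_of_nonpos (by linarith [hy.2]) (by linarith) (by linarith)
    · intro y hy
      exact Real.rpow_nonneg (by linarith [hy.2]) _
    · exact (Continuous.intervalIntegrable (by fun_prop) _ _)
    · intro c hc
      rw [intervalIntegral.integral_ofReal, Complex.norm_real, Real.norm_eq_abs,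
        intervalIntegral.integral_comp_neg, neg_neg,
        intervalIntegral.integral_eq_sub_of_hasDerivAt (fun x _ => hg x)
          (hg'.intervalIntegrable _ _)]
      have e1 := hA (-c) ⟨by linarith [hc.2], by linarith [hc.1]⟩
      have e2 := hA (t + h) ⟨by linarith, hbh.le⟩
      have := abs_sub (g (-c)) (g (t + h))
      linarith

/-! ### The integrable profile -/

/-- The profile `D` such that, after division by `w ^ 2`, the fractional derivative of order `ρ` of
the weighted kernel at `t` is at most a multiple of `t ^ (-ρ) * D (w * t)`. -/
def tailProfile (q : ℝ → ℝ) (k : ℕ) (σ ρ v : ℝ) : ℝ :=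
  if v ≤ 1 then v ^ ρ else v ^ (σ - 1) * kerTail q k (1 / v) + v ^ (σ - 3)

namespace IsNevanlinnaKernel

variable {α : ℝ} {q : ℝ → ℝ} {κ : ℕ}

/-- Integrability of the profile on `(0, ∞)`. The substitution `v ↦ 1 / v` turns the decisive term
into the integral that the tail condition on the kernel at `t = 1` declares finite. -/
theorem integrableOn_tailProfile (hq : IsNevanlinnaKernel α q) (hκ : ⌊α⌋₊ = κ + 1) {σ ρ : ℝ}
    (hσ : σ = α - (κ + 1)) (hσ1 : σ < 1) (hρ : 0 ≤ ρ) :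
    IntegrableOn (tailProfile q (κ + 1) σ ρ) (Ioi 0) := by
  rw [← Ioc_union_Ioi_eq_Ioi zero_le_one]
  refine IntegrableOn.union ?_ ?_
  · have h : IntegrableOn (fun v : ℝ => v ^ ρ) (Ioc 0 1) :=
      (intervalIntegrable_iff_integrableOn_Ioc_of_le zero_le_one).mp
        (intervalIntegral.intervalIntegrable_rpow' (by linarith))
    exact h.congr_fun (fun v hv => by rw [tailProfile, if_pos hv.2]) measurableSet_Ioc
  · have h1 : IntegrableOn (fun v : ℝ => v ^ (σ - 3)) (Ioi 1) :=
      integrableOn_Ioi_rpow_of_lt (by linarith) zero_lt_one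
    have himg : (fun v : ℝ => v⁻¹) '' Ioi 1 = Ioo 0 1 := by
      ext y
      constructor
      · rintro ⟨v, hv, rfl⟩
        have hv1 : (1 : ℝ) < v := hv
        exact ⟨by positivity, inv_lt_one_of_one_lt₀ hv1⟩
      · intro hy
        exact ⟨y⁻¹, (one_lt_inv₀ hy.1).mpr hy.2, inv_inv y⟩
    obtain ⟨C, hC⟩ := hq.tail_bound
    have h2 := (hC 1 ⟨zero_lt_one, le_rfl⟩).1
    rw [hκ, intervalIntegrable_iff_integrableOn_Ioo_of_le zero_le_one, ← himg,
      integrableOn_image_iff_integrableOn_abs_deriv_smul (f' := fun v => -(v ^ 2)⁻¹)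
        measurableSet_Ioi (fun v hv => (hasDerivAt_inv (by
          have : (1 : ℝ) < v := hv
          positivity)).hasDerivWithinAt) inv_injective.injOn] at h2
    refine (h2.add h1).congr_fun (fun v hv => ?_) measurableSet_Ioi
    have hv1 : (1 : ℝ) < v := hv
    have hv0 : 0 < v := by linarith
    simp only [Pi.add_apply, smul_eq_mul]
    rw [tailProfile, if_neg (not_le.mpr hv1), abs_neg, abs_of_pos (by positivity), one_div]
    congr 1
    have e : v ^ (σ - 1) = (v ^ 2)⁻¹ * v ^ (1 + σ) := by
      rw [← Real.rpow_natCast, ← Real.rpow_neg hv0.le, ← Real.rpow_add hv0]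
      congr 1; push_cast; ring
    rw [e, Real.inv_rpow hv0.le]
    have e2 : (1 + α - ((κ + 1 : ℕ) : ℝ)) = 1 + σ := by rw [hσ]; push_cast; ring
    rw [e2]
    field_simp

/-- The bounds for the weighted kernel at `t` hold, up to constants, at all points of `[t, π]`. -/
theorem exists_sup_iteratedDeriv_weightedKernel_le (hq : IsNevanlinnaKernel α q)
    (hκ : ⌊α⌋₊ = κ + 1) {r m : ℕ} (hm : κ = r + m) (i : ℕ) : ∃ C : ℝ, 0 ≤ C ∧
      ∀ w t s : ℝ, 0 < w → 0 < t → t ≤ s → s ≤ Real.pi →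
      (w * t ≤ 1 → |iteratedDeriv i (weightedKernel q r w) s| ≤ C * w ^ (i + 2)) ∧
      (1 ≤ w * t → |iteratedDeriv i (weightedKernel q r w) s| ≤
        C * (w ^ (i + 1) / (w ^ m * t ^ (m + 1)) * kerTail q (κ + 1) (1 / (w * t)) +
          1 / (w * t ^ (i + 3)))) := by
  obtain ⟨C₁, hC₁0, hC₁⟩ := hq.exists_abs_iteratedDeriv_weightedKernel_le_pow hκ r i
  obtain ⟨C₂, hC₂0, hC₂⟩ := hq.exists_abs_iteratedDeriv_weightedKernel_le hκ hm i
  set Q₁ := kerTail q (κ + 1) 1 with hQ₁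
  have hQ₁0 : 0 ≤ Q₁ := hq.kerTail_nonneg hκ ⟨zero_le_one, le_rfl⟩
  refine ⟨C₁ + C₂ * (Q₁ + 1), by positivity, fun w t s hw ht hts hsπ => ?_⟩
  have hs : 0 < s := ht.trans_le hts
  have hws0 : 0 < w * s := by positivity
  have hwts : w * t ≤ w * s := by gcongr
  refine ⟨fun hwt => ?_, fun hwt => ?_⟩
  · rcases le_total (w * s) 1 with hws | hws
    · refine (hC₁ w s hw hs hws).trans ?_
      gcongr
      have : 0 ≤ C₂ * (Q₁ + 1) := by positivity
      linarith
    · have hmem : 1 / (w * s) ∈ Icc (0 : ℝ) 1 :=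
        ⟨by positivity, by rw [div_le_one hws0]; exact hws⟩
      have hQ : kerTail q (κ + 1) (1 / (w * s)) ≤ Q₁ :=
        hq.kerTail_monotoneOn hκ hmem ⟨zero_le_one, le_rfl⟩ hmem.2
      have hQ0 := hq.kerTail_nonneg hκ hmem
      have e1 : w ^ (i + 1) / (w ^ m * s ^ (m + 1)) ≤ w ^ (i + 2) := by
        have h1 : 1 ≤ (w * s) ^ (m + 1) := one_le_pow₀ hws
        calc w ^ (i + 1) / (w ^ m * s ^ (m + 1))
            ≤ w ^ (i + 1) / (w ^ m * s ^ (m + 1)) * (w * s) ^ (m + 1) :=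
              le_mul_of_one_le_right (by positivity) h1
          _ = w ^ (i + 2) := by field_simp; ring
      have e2 : 1 / (w * s ^ (i + 3)) ≤ w ^ (i + 2) := by
        have h1 : 1 ≤ (w * s) ^ (i + 3) := one_le_pow₀ hws
        calc 1 / (w * s ^ (i + 3)) ≤ 1 / (w * s ^ (i + 3)) * (w * s) ^ (i + 3) :=
              le_mul_of_one_le_right (by positivity) h1
          _ = w ^ (i + 2) := by field_simp; ring
      calc _ ≤ _ := hC₂ w s hw hs hsπ hws
        _ ≤ C₂ * (w ^ (i + 2) * Q₁ + w ^ (i + 2)) := by gcongr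
        _ = C₂ * (Q₁ + 1) * w ^ (i + 2) := by ring
        _ ≤ _ := by gcongr; linarith
  · have hws := hwt.trans hwts
    have hwt0 : 0 < w * t := by positivity
    have hmem : 1 / (w * s) ∈ Icc (0 : ℝ) 1 :=
      ⟨by positivity, by rw [div_le_one hws0]; exact hws⟩
    have hmemt : 1 / (w * t) ∈ Icc (0 : ℝ) 1 :=
      ⟨by positivity, by rw [div_le_one hwt0]; exact hwt⟩
    have hQ : kerTail q (κ + 1) (1 / (w * s)) ≤ kerTail q (κ + 1) (1 / (w * t)) :=
      hq.kerTail_monotoneOn hκ hmem hmemt (by gcongr)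
    have hQ0 := hq.kerTail_nonneg hκ hmem
    have hQ0' := hq.kerTail_nonneg hκ hmemt
    have hC : C₂ ≤ C₁ + C₂ * (Q₁ + 1) := by nlinarith [mul_nonneg hC₂0 hQ₁0]
    calc _ ≤ _ := hC₂ w s hw hs hsπ hws
      _ ≤ _ := by gcongr

/-- The fractional derivative of the weighted kernel, by interpolation at distance `1 / w`. -/
theorem exists_abs_fracDeriv_weightedKernel_le (hq : IsNevanlinnaKernel α q)
    (hκ : ⌊α⌋₊ = κ + 1) {r m : ℕ} (hm : κ = r + m) {σ ρ : ℝ} (hσ0 : 0 ≤ σ) (hσ1 : σ < 1)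
    (hρ : ρ = m + σ) : ∃ C : ℝ, 0 ≤ C ∧ ∀ w t : ℝ, 0 < w → t ∈ Ioo 0 Real.pi →
      |∫ s in t..Real.pi, (s - t) ^ (-σ) * iteratedDeriv (m + 1) (weightedKernel q r w) s| / w ^ 2
        ≤ C * (t ^ (-ρ) * tailProfile q (κ + 1) σ ρ (w * t)) := by
  obtain ⟨C₁, hC₁0, hC₁⟩ := hq.exists_sup_iteratedDeriv_weightedKernel_le hκ hm m
  obtain ⟨C₂, hC₂0, hC₂⟩ := hq.exists_sup_iteratedDeriv_weightedKernel_le hκ hm (m + 1)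
  have hσ' : 0 < 1 - σ := by linarith
  refine ⟨C₂ * (1 / (1 - σ)) + 2 * C₁, by positivity, fun w t hw ht => ?_⟩
  have ht0 := ht.1
  have key : ∀ β : ℝ, (∀ s ∈ Ioc t Real.pi, |iteratedDeriv m (weightedKernel q r w) s| ≤ C₁ * β) →
      (∀ s ∈ Ioc t Real.pi, |iteratedDeriv (m + 1) (weightedKernel q r w) s| ≤ C₂ * (w * β)) →
      |∫ s in t..Real.pi, (s - t) ^ (-σ) * iteratedDeriv (m + 1) (weightedKernel q r w) s| / w ^ 2
        ≤ (C₂ * (1 / (1 - σ)) + 2 * C₁) * (β * w ^ σ / w ^ 2) := by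
    intro β h1 h2
    have h := abs_integral_rpow_mul_deriv_le hσ0 hσ1 ht.2 (inv_pos.mpr hw)
      (g := iteratedDeriv m (weightedKernel q r w))
      (g' := iteratedDeriv (m + 1) (weightedKernel q r w)) (fun s => by
        rw [iteratedDeriv_succ]
        exact (((contDiff_weightedKernel q r w (n := (m + 1 : ℕ))).differentiable_iteratedDeriv m
          (by exact_mod_cast Nat.lt_succ_self m)) s).hasDerivAt)
      ((contDiff_weightedKernel q r w (n := (m + 1 : ℕ))).continuous_iteratedDeriv _ le_rfl) h1 h2
    have e1 : (w⁻¹) ^ (1 - σ) = w ^ σ / w := by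
      rw [Real.inv_rpow hw.le, Real.rpow_sub hw, Real.rpow_one, inv_div]
    have e2 : (w⁻¹) ^ (-σ) = w ^ σ := by
      rw [Real.inv_rpow hw.le, Real.rpow_neg hw.le, inv_inv]
    rw [e1, e2] at h
    rw [← mul_div_assoc]
    gcongr
    refine h.trans (le_of_eq ?_)
    field_simp
  rcases le_or_gt (w * t) 1 with hwt | hwt
  · refine (key (w ^ (m + 2)) (fun s hs => (hC₁ w t s hw ht0 hs.1.le hs.2).1 hwt)
      (fun s hs => ?_)).trans (le_of_eq ?_)
    · refine ((hC₂ w t s hw ht0 hs.1.le hs.2).1 hwt).trans (le_of_eq ?_)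
      ring
    · congr 1
      rw [tailProfile, if_pos hwt, Real.mul_rpow hw.le ht0.le, mul_left_comm, ← Real.rpow_add ht0,
        neg_add_cancel, Real.rpow_zero, mul_one, hρ, Real.rpow_add hw, Real.rpow_natCast]
      field_simp
      ring
  · refine (key (w ^ (m + 1) / (w ^ m * t ^ (m + 1)) * kerTail q (κ + 1) (1 / (w * t)) +
          1 / (w * t ^ (m + 3))) (fun s hs => (hC₁ w t s hw ht0 hs.1.le hs.2).2 hwt.le)
      (fun s hs => ?_)).trans (le_of_eq ?_)
    · refine ((hC₂ w t s hw ht0 hs.1.le hs.2).2 hwt.le).trans ?_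
      gcongr
      rw [mul_add]
      refine add_le_add (le_of_eq (by ring)) ?_
      rw [mul_one_div, div_le_div_iff₀ (by positivity) (by positivity)]
      calc 1 * (w * t ^ (m + 3)) ≤ w * t ^ (m + 3) * (w * t) := by
            rw [one_mul]; exact le_mul_of_one_le_right (by positivity) hwt.le
        _ = w * (w * t ^ (m + 1 + 3)) := by ring
    · congr 1
      rw [tailProfile, if_neg (not_le.mpr hwt), Real.mul_rpow hw.le ht0.le,
        Real.mul_rpow hw.le ht0.le, hρ, neg_add, Real.rpow_add ht0, Real.rpow_sub hw,
        Real.rpow_sub hw, Real.rpow_sub ht0, Real.rpow_sub ht0, Real.rpow_neg ht0.le,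
        Real.rpow_neg ht0.le, Real.rpow_natCast, Real.rpow_one, Real.rpow_one]
      have e3 : w ^ (3 : ℝ) = w ^ 3 := by norm_cast
      have e4 : t ^ (3 : ℝ) = t ^ 3 := by norm_cast
      have : t ^ σ ≠ 0 := (Real.rpow_pos_of_pos ht0 σ).ne'
      rw [e3, e4]
      field_simp
      ring

/-- Comparison of the kernel bounds at the end point `π` with the profile. -/
theorem le_mul_tailProfile (hq : IsNevanlinnaKernel α q) (hκ : ⌊α⌋₊ = κ + 1) {σ : ℝ}
    (hσ0 : 0 ≤ σ) (ρ : ℝ) (a b e : ℕ) (hab : a ≤ b + 1) (c : ℕ) : ∃ C : ℝ, 0 ≤ C ∧ ∀ w : ℝ, 1 ≤ w →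
      (w ^ a / (w ^ b * Real.pi ^ c) * kerTail q (κ + 1) (1 / (w * Real.pi)) +
        1 / (w * Real.pi ^ e)) / w ^ 2 ≤ C * tailProfile q (κ + 1) σ ρ (w * Real.pi) := by
  have hπ : 1 ≤ Real.pi := by linarith [Real.pi_gt_three]
  refine ⟨Real.pi ^ 3, by positivity, fun w hw => ?_⟩
  have hw0 : 0 < w := by linarith
  have hwπ : 1 < w * Real.pi := by nlinarith [Real.pi_gt_three]
  have hQ : 0 ≤ kerTail q (κ + 1) (1 / (w * Real.pi)) :=
    hq.kerTail_nonneg hκ ⟨by positivity, by rw [div_le_one (by positivity)]; exact hwπ.le⟩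
  rw [tailProfile, if_neg (not_le.mpr hwπ), add_div, mul_add]
  have hσw : 1 ≤ (w * Real.pi) ^ σ := Real.one_le_rpow hwπ.le hσ0
  have p1 : (w * Real.pi) ^ (σ - 1) = (w * Real.pi) ^ σ / (w * Real.pi) := by
    rw [Real.rpow_sub (by positivity), Real.rpow_one]
  have p3 : (w * Real.pi) ^ (σ - 3) = (w * Real.pi) ^ σ / (w * Real.pi) ^ 3 := by
    rw [Real.rpow_sub (by positivity)]; norm_cast
  rw [p1, p3]
  have hπc : 1 ≤ Real.pi ^ c := one_le_pow₀ hπ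
  have hπe : 1 ≤ Real.pi ^ e := one_le_pow₀ hπ
  refine add_le_add ?_ ?_
  · have h1 : w ^ a / (w ^ b * Real.pi ^ c) ≤ w := by
      rw [div_le_iff₀ (by positivity)]
      calc w ^ a ≤ w ^ (b + 1) := pow_le_pow_right₀ hw hab
        _ ≤ w ^ (b + 1) * Real.pi ^ c := le_mul_of_one_le_right (by positivity) hπc
        _ = w * (w ^ b * Real.pi ^ c) := by ring
    calc w ^ a / (w ^ b * Real.pi ^ c) * kerTail q (κ + 1) (1 / (w * Real.pi)) / w ^ 2
        ≤ w * kerTail q (κ + 1) (1 / (w * Real.pi)) / w ^ 2 := by gcongr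
      _ = Real.pi * (1 / (w * Real.pi) * kerTail q (κ + 1) (1 / (w * Real.pi))) := by field_simp
      _ ≤ Real.pi ^ 3 * ((w * Real.pi) ^ σ / (w * Real.pi) *
          kerTail q (κ + 1) (1 / (w * Real.pi))) := by
        gcongr
        exact le_self_pow₀ hπ (by norm_num)
  · calc 1 / (w * Real.pi ^ e) / w ^ 2 ≤ 1 / (w * 1) / w ^ 2 := by gcongr
      _ = Real.pi ^ 3 * (1 / (w * Real.pi) ^ 3) := by field_simp
      _ ≤ Real.pi ^ 3 * ((w * Real.pi) ^ σ / (w * Real.pi) ^ 3) := by gcongr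

theorem exists_abs_iteratedDeriv_weightedKernel_pi_le (hq : IsNevanlinnaKernel α q)
    (hκ : ⌊α⌋₊ = κ + 1) {r m : ℕ} (hm : κ = r + m) {σ : ℝ} (hσ0 : 0 ≤ σ) (ρ : ℝ) {i : ℕ}
    (hi : i ≤ m) : ∃ C : ℝ, 0 ≤ C ∧ ∀ w : ℝ, 1 ≤ w →
      |iteratedDeriv i (weightedKernel q r w) Real.pi| / w ^ 2 ≤
        C * tailProfile q (κ + 1) σ ρ (w * Real.pi) := by
  obtain ⟨C₁, hC₁0, hC₁⟩ := hq.exists_abs_iteratedDeriv_weightedKernel_le hκ hm i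
  obtain ⟨C₂, hC₂0, hC₂⟩ := hq.le_mul_tailProfile hκ hσ0 ρ (i + 1) m (i + 3) (by omega) (m + 1)
  refine ⟨C₁ * C₂, by positivity, fun w hw => ?_⟩
  have h := hC₁ w Real.pi (by linarith) Real.pi_pos le_rfl (by nlinarith [Real.pi_gt_three])
  rw [mul_assoc]
  refine le_trans ?_ (mul_le_mul_of_nonneg_left (hC₂ w hw) hC₁0)
  rw [← mul_div_assoc]
  gcongr

theorem exists_abs_kernelSum_pi_le (hq : IsNevanlinnaKernel α q) (hκ : ⌊α⌋₊ = κ + 1) {σ : ℝ}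
    (hσ0 : 0 ≤ σ) (ρ : ℝ) {j : ℕ} (hj : j ≤ κ) : ∃ C : ℝ, 0 ≤ C ∧ ∀ w : ℝ, 1 ≤ w →
      |kernelSum q j w Real.pi| / w ^ 2 ≤ C * tailProfile q (κ + 1) σ ρ (w * Real.pi) := by
  obtain ⟨C₁, hC₁0, hC₁⟩ := hq.exists_abs_kernelSum_le hκ j
  obtain ⟨C₂, hC₂0, hC₂⟩ := hq.le_mul_tailProfile hκ hσ0 ρ (j + 1) κ (j + 3) (by omega) (κ + 1)
  refine ⟨C₁ * C₂, by positivity, fun w hw => ?_⟩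
  have h := hC₁ w Real.pi (by linarith) Real.pi_pos le_rfl (by nlinarith [Real.pi_gt_three])
  rw [mul_assoc]
  refine le_trans ?_ (mul_le_mul_of_nonneg_left (hC₂ w hw) hC₁0)
  rw [← mul_div_assoc]
  gcongr

end IsNevanlinnaKernel

/-! ### Fractional integration by parts -/

/-- Fubini on the triangle `a < x < y ≤ b` for the kernel `(y - x) ^ (p - 1)`; integrability comes
from that of the convolution integrand. -/
theorem integral_mul_integral_rpow_swap {f g : ℝ → ℝ} {a b p M : ℝ} (hab : a ≤ b) (hp : 0 < p)
    (hf : IntervalIntegrable f volume a b)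
    (hgm : AEStronglyMeasurable g (volume.restrict (Ioc a b)))
    (hgM : ∀ y ∈ Ioc a b, |g y| ≤ M) :
    ∫ x in a..b, f x * ∫ y in x..b, (y - x) ^ (p - 1) * g y =
      ∫ y in a..b, g y * ∫ x in a..y, (y - x) ^ (p - 1) * f x := by
  set f' : ℝ → ℝ := (Ioc a b).indicator f with hf'
  set g' : ℝ → ℝ := (Ioc a b).indicator g with hg'
  set k : ℝ → ℝ := (Ioc 0 (b - a)).indicator fun x => x ^ (p - 1) with hk
  have hf'i : Integrable f' :=
    ((intervalIntegrable_iff_integrableOn_Ioc_of_le hab).mp hf).integrable_indicator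
      measurableSet_Ioc
  have hki : Integrable k :=
    ((intervalIntegrable_iff_integrableOn_Ioc_of_le (by linarith)).mp
      (intervalIntegral.intervalIntegrable_rpow' (by linarith))).integrable_indicator
      measurableSet_Ioc
  have hg'm : AEStronglyMeasurable g' volume :=
    (aestronglyMeasurable_indicator_iff measurableSet_Ioc).mpr hgm
  have hg'M : ∀ y, ‖g' y‖ ≤ |M| := by
    intro y
    by_cases hy : y ∈ Ioc a b
    · rw [hg', indicator_of_mem hy, Real.norm_eq_abs]
      exact (hgM y hy).trans (le_abs_self M)
    · rw [hg', indicator_of_notMem hy, norm_zero]; exact abs_nonneg _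
  have hint : Integrable (Function.uncurry fun y x => f' x * k (y - x) * g' y)
      (volume.prod volume) := by
    have h1 := hf'i.convolution_integrand (ContinuousLinearMap.mul ℝ ℝ) hki
    exact h1.mul_bdd (c := |M|) hg'm.comp_fst (Filter.Eventually.of_forall fun z => hg'M z.1)
  have hswap := integral_integral_swap hint
  have hL : ∀ y, ∫ x, f' x * k (y - x) * g' y =
      (Ioc a b).indicator (fun y => g y * ∫ x in a..y, (y - x) ^ (p - 1) * f x) y := by
    intro y
    by_cases hy : y ∈ Ioc a b
    · have h1 : ∀ x, f' x * k (y - x) * g' y =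
          (Ioo a y).indicator (fun x => (y - x) ^ (p - 1) * f x) x * g y := by
        intro x
        rw [hg', indicator_of_mem hy]
        congr 1
        by_cases hx : x ∈ Ioo a y
        · rw [indicator_of_mem hx, hf', indicator_of_mem (show x ∈ Ioc a b from ⟨hx.1, hx.2.le.trans hy.2⟩),
            hk, indicator_of_mem (show y - x ∈ Ioc 0 (b - a) from
              ⟨by linarith [hx.2], by linarith [hx.1, hy.2]⟩), mul_comm]
        · rw [indicator_of_notMem hx]
          by_cases hxa : a < x
          · have : y - x ∉ Ioc 0 (b - a) := fun h => hx ⟨hxa, by linarith [h.1]⟩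
            rw [hk, indicator_of_notMem this, mul_zero]
          · rw [hf', indicator_of_notMem (fun h => hxa h.1), zero_mul]
      simp_rw [h1]
      rw [integral_mul_const, integral_indicator measurableSet_Ioo, indicator_of_mem hy,
        intervalIntegral.integral_of_le hy.1.le, integral_Ioc_eq_integral_Ioo, mul_comm]
    · rw [indicator_of_notMem hy]
      have : ∀ x, f' x * k (y - x) * g' y = 0 := fun x => by
        rw [hg', indicator_of_notMem hy, mul_zero]
      simp_rw [this, integral_zero]
  have hR : ∀ x, ∫ y, f' x * k (y - x) * g' y =
      (Ioc a b).indicator (fun x => f x * ∫ y in x..b, (y - x) ^ (p - 1) * g y) x := by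
    intro x
    by_cases hx : x ∈ Ioc a b
    · have h1 : ∀ y, f' x * k (y - x) * g' y =
          f x * (Ioc x b).indicator (fun y => (y - x) ^ (p - 1) * g y) y := by
        intro y
        rw [hf', indicator_of_mem hx, mul_assoc]
        congr 1
        by_cases hy : y ∈ Ioc x b
        · rw [indicator_of_mem hy, hg', indicator_of_mem (show y ∈ Ioc a b from ⟨hx.1.trans hy.1, hy.2⟩),
            hk, indicator_of_mem (show y - x ∈ Ioc 0 (b - a) from
              ⟨by linarith [hy.1], by linarith [hy.2, hx.1]⟩)]
        · rw [indicator_of_notMem hy]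
          by_cases hyb : y ≤ b
          · have : y - x ∉ Ioc 0 (b - a) := fun h => hy ⟨by linarith [h.1], hyb⟩
            rw [hk, indicator_of_notMem this, zero_mul]
          · rw [hg', indicator_of_notMem (fun h => hyb h.2), mul_zero]
      simp_rw [h1]
      rw [integral_const_mul, integral_indicator measurableSet_Ioc, indicator_of_mem hx,
        intervalIntegral.integral_of_le hx.2]
    · rw [indicator_of_notMem hx]
      have : ∀ y, f' x * k (y - x) * g' y = 0 := fun y => by
        rw [hf', indicator_of_notMem hx, zero_mul, zero_mul]
      simp_rw [this, integral_zero]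
  simp_rw [hL, hR] at hswap
  rw [integral_indicator measurableSet_Ioc, integral_indicator measurableSet_Ioc] at hswap
  rw [intervalIntegral.integral_of_le hab, intervalIntegral.integral_of_le hab, hswap]

/-- The beta integral between `u` and `s`. -/
theorem exists_integral_rpow_mul_rpow_eq {σ ρ : ℝ} {m : ℕ} (hσ1 : σ < 1) (hρ0 : 0 < ρ)
    (hρ : ρ = m + σ) : ∃ B : ℝ, 0 < B ∧ ∀ u s : ℝ, u < s →
      ∫ t in u..s, (s - t) ^ (1 - σ - 1) * (t - u) ^ (ρ - 1) = B * (s - u) ^ m := by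
  refine ⟨(Complex.betaIntegral ρ (1 - σ : ℝ)).re, ?_, fun u s hus => ?_⟩
  · rw [← ProbabilityTheory.beta_eq_betaIntegralReal _ _ hρ0 (by linarith)]
    exact ProbabilityTheory.beta_pos hρ0 (by linarith)
  · have ha : 0 < s - u := by linarith
    have h := Complex.betaIntegral_scaled ρ (1 - σ : ℝ) ha
    have h1 : ∀ x ∈ uIcc 0 (s - u), (x : ℂ) ^ ((ρ : ℂ) - 1) *
        (((s - u : ℝ) : ℂ) - x) ^ (((1 - σ : ℝ) : ℂ) - 1) =
        (((s - u - x) ^ (1 - σ - 1) * x ^ (ρ - 1) : ℝ) : ℂ) := by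
      intro x hx
      rw [uIcc_of_le ha.le] at hx
      rw [Complex.ofReal_mul, Complex.ofReal_cpow hx.1, Complex.ofReal_cpow (by linarith [hx.2])]
      push_cast
      ring
    rw [intervalIntegral.integral_congr h1, intervalIntegral.integral_ofReal] at h
    have h2 : (((s - u : ℝ) : ℂ)) ^ ((ρ : ℂ) + ((1 - σ : ℝ) : ℂ) - 1) = (((s - u) ^ m : ℝ) : ℂ) := by
      have : (ρ : ℂ) + ((1 - σ : ℝ) : ℂ) - 1 = (m : ℂ) := by rw [hρ]; push_cast; ring
      rw [this, Complex.cpow_natCast]; push_cast; ring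
    rw [h2] at h
    have h3 := congrArg Complex.re h
    rw [Complex.re_ofReal_mul, Complex.ofReal_re] at h3
    have h4 := intervalIntegral.integral_comp_sub_right (a := u) (b := s)
      (fun x => (s - u - x) ^ (1 - σ - 1) * x ^ (ρ - 1)) u
    rw [sub_self, h3] at h4
    rw [mul_comm, ← h4]
    refine intervalIntegral.integral_congr fun t _ => ?_
    rw [sub_sub_sub_cancel_right]

theorem measurable_integral_rpow_mul {g : ℝ → ℝ} (hg : Measurable g) (b p : ℝ) :
    AEStronglyMeasurable (fun t => ∫ s in t..b, (s - t) ^ p * g s)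
      (volume.restrict (Iic b)) := by
  set S : Set (ℝ × ℝ) := {z | z.1 < z.2 ∧ z.2 ≤ b} with hS
  have hSm : MeasurableSet S :=
    (measurableSet_lt measurable_fst measurable_snd).inter
      (measurableSet_le measurable_snd measurable_const)
  have hF : StronglyMeasurable (S.indicator fun z : ℝ × ℝ => (z.2 - z.1) ^ p * g z.2) :=
    (Measurable.indicator (by fun_prop) hSm).stronglyMeasurable
  have h := StronglyMeasurable.integral_prod_right (ν := (volume : Measure ℝ))
    (f := fun t s => S.indicator (fun z : ℝ × ℝ => (z.2 - z.1) ^ p * g z.2) (t, s)) hF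
  refine h.aestronglyMeasurable.congr ?_
  refine (ae_restrict_iff' measurableSet_Iic).mpr (Filter.Eventually.of_forall fun t ht => ?_)
  simp only []
  rw [intervalIntegral.integral_of_le ht, ← integral_indicator measurableSet_Ioc]
  rfl

/-- Taylor's formula at the right end point `b`. -/
theorem eq_taylor_sum_add_integral {G : ℝ → ℝ} {m : ℕ} (hG : ContDiff ℝ (m + 1 : ℕ) G) {u b : ℝ}
    (hub : u < b) : G u = ∑ i ∈ Finset.range (m + 1),
        (i.factorial : ℝ)⁻¹ * (u - b) ^ i * iteratedDeriv i G b +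
      (-1) ^ (m + 1) / m.factorial *
        ∫ s in u..b, (s - u) ^ m * iteratedDeriv (m + 1) G s := by
  have h := taylor_integral_remainder (x := u) (x₀ := b) (n := m) hG.contDiffOn
  have hu : UniqueDiffOn ℝ (uIcc b u) := uniqueDiffOn_uIcc hub.ne'
  have e1 : taylorWithinEval G m (uIcc b u) b u = ∑ i ∈ Finset.range (m + 1),
      (i.factorial : ℝ)⁻¹ * (u - b) ^ i * iteratedDeriv i G b := by
    rw [taylor_within_apply]
    refine Finset.sum_congr rfl fun i hi => ?_
    rw [smul_eq_mul, iteratedDerivWithin_eq_iteratedDeriv hu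
      (hG.contDiffAt.of_le (by exact_mod_cast (Finset.mem_range.mp hi).le)) left_mem_uIcc]
  have e2 : ∫ s in b..u, ((u - s) ^ m / (m.factorial : ℝ)) •
      iteratedDerivWithin (m + 1) G (uIcc b u) s = (-1) ^ (m + 1) / m.factorial *
        ∫ s in u..b, (s - u) ^ m * iteratedDeriv (m + 1) G s := by
    rw [intervalIntegral.integral_symm u b, ← intervalIntegral.integral_const_mul,
      ← intervalIntegral.integral_neg]
    refine intervalIntegral.integral_congr fun s hs => ?_
    rw [iteratedDerivWithin_eq_iteratedDeriv hu hG.contDiffAt (by rwa [uIcc_comm] at hs)]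
    have : (u - s) ^ m = (-1) ^ m * (s - u) ^ m := by rw [← mul_pow]; ring
    rw [this, smul_eq_mul, pow_succ]
    ring
  rw [e1, e2] at h
  linarith

/-- Fractional integration by parts. Taylor's formula at `b` gives an integral of order `m + 1`,
which the beta integral splits into orders `ρ` and `1 - σ`; the first part is moved onto `h`. The
constants depend on `h` only, not on `G`. -/
theorem exists_integral_mul_eq_fracInt {h : ℝ → ℝ} {b σ ρ : ℝ} {m : ℕ} (hb : 0 < b)
    (hh : IntervalIntegrable h volume 0 b) (hσ0 : 0 ≤ σ) (hσ1 : σ < 1) (hρ : ρ = m + σ) :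
    ∃ (c : ℕ → ℝ) (c' : ℝ), ∀ G : ℝ → ℝ, ContDiff ℝ (m + 1 : ℕ) G →
      ∫ u in (0 : ℝ)..b, h u * G u = ∑ i ∈ Finset.range (m + 1), c i * iteratedDeriv i G b +
        c' * ∫ t in (0 : ℝ)..b, fracInt h ρ t *
          ∫ s in t..b, (s - t) ^ (-σ) * iteratedDeriv (m + 1) G s := by
  suffices hmain : ∃ c' : ℝ, ∀ G : ℝ → ℝ, ContDiff ℝ (m + 1 : ℕ) G →
      ∫ u in (0 : ℝ)..b, h u * ((-1) ^ (m + 1) / m.factorial *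
        ∫ s in u..b, (s - u) ^ m * iteratedDeriv (m + 1) G s) =
        c' * ∫ t in (0 : ℝ)..b, fracInt h ρ t *
          ∫ s in t..b, (s - t) ^ (-σ) * iteratedDeriv (m + 1) G s by
    obtain ⟨c', hc'⟩ := hmain
    refine ⟨fun i => ∫ u in (0 : ℝ)..b, h u * ((i.factorial : ℝ)⁻¹ * (u - b) ^ i), c',
      fun G hG => ?_⟩
    have e1 : ∀ u ∈ Ioo 0 b, h u * G u - ∑ i ∈ Finset.range (m + 1),
        h u * ((i.factorial : ℝ)⁻¹ * (u - b) ^ i) * iteratedDeriv i G b =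
        h u * ((-1) ^ (m + 1) / m.factorial *
        ∫ s in u..b, (s - u) ^ m * iteratedDeriv (m + 1) G s) := by
      intro u hu
      have h1 : ∑ i ∈ Finset.range (m + 1),
        h u * ((i.factorial : ℝ)⁻¹ * (u - b) ^ i) * iteratedDeriv i G b =
          h u * ∑ i ∈ Finset.range (m + 1),
            (i.factorial : ℝ)⁻¹ * (u - b) ^ i * iteratedDeriv i G b := by
        rw [Finset.mul_sum]; exact Finset.sum_congr rfl fun i _ => by ring
      rw [h1, ← mul_sub]
      congr 1
      rw [eq_taylor_sum_add_integral hG hu.2]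
      ring
    have hi1 : IntervalIntegrable (fun u => h u * G u) volume 0 b :=
      hh.mul_continuousOn hG.continuous.continuousOn
    have hi2 : ∀ i ∈ Finset.range (m + 1), IntervalIntegrable (fun u =>
        h u * ((i.factorial : ℝ)⁻¹ * (u - b) ^ i) * iteratedDeriv i G b) volume 0 b :=
      fun i _ => (hh.mul_continuousOn (by fun_prop)).mul_const _
    rw [← hc' G hG]
    have e2 : ∑ i ∈ Finset.range (m + 1), (∫ u in (0 : ℝ)..b,
        h u * ((i.factorial : ℝ)⁻¹ * (u - b) ^ i)) * iteratedDeriv i G b =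
        ∫ u in (0 : ℝ)..b, ∑ i ∈ Finset.range (m + 1),
          h u * ((i.factorial : ℝ)⁻¹ * (u - b) ^ i) * iteratedDeriv i G b := by
      rw [intervalIntegral.integral_finsetSum hi2]
      exact Finset.sum_congr rfl fun i _ => (intervalIntegral.integral_mul_const _ _).symm
    have hi3 : IntervalIntegrable (fun u => ∑ i ∈ Finset.range (m + 1),
        h u * ((i.factorial : ℝ)⁻¹ * (u - b) ^ i) * iteratedDeriv i G b) volume 0 b := by
      simpa only [Finset.sum_fn] using IntervalIntegrable.sum _ hi2
    rw [e2, ← sub_eq_iff_eq_add', ← intervalIntegral.integral_sub hi1 hi3]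
    refine intervalIntegral.integral_congr_uIoo fun u hu => ?_
    rw [uIoo_of_le hb.le] at hu
    exact e1 u hu
  rcases eq_or_lt_of_le (by rw [hρ]; positivity : 0 ≤ ρ) with h0 | hρ0
  · have hm0 : m = 0 := by
      have : (m : ℝ) ≤ 0 := by linarith
      exact_mod_cast le_antisymm this (Nat.cast_nonneg m)
    subst hm0
    have hσ : σ = 0 := by rw [hρ] at h0; simpa using h0.symm
    refine ⟨-1, fun G hG => ?_⟩
    rw [← intervalIntegral.integral_const_mul]
    refine intervalIntegral.integral_congr fun u _ => ?_
    simp [fracInt, ← h0, hσ]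
  · obtain ⟨B, hB0, hB⟩ := exists_integral_rpow_mul_rpow_eq hσ1 hρ0 hρ
    refine ⟨(-1) ^ (m + 1) / m.factorial * B⁻¹ * Real.Gamma ρ, fun G hG => ?_⟩
    set g := iteratedDeriv (m + 1) G with hg
    have hgc : Continuous g := hG.continuous_iteratedDeriv _ le_rfl
    set X : ℝ → ℝ := fun t => ∫ s in t..b, (s - t) ^ (-σ) * g s with hX
    obtain ⟨M, hM⟩ := isCompact_Icc.exists_bound_of_continuousOn (s := Icc 0 b) hgc.continuousOn
    have hM0 : 0 ≤ M := (norm_nonneg _).trans (hM 0 ⟨le_rfl, hb.le⟩)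
    have hsemi : ∀ u ∈ Ioo 0 b, ∫ s in u..b, (s - u) ^ m * g s =
        B⁻¹ * ∫ t in u..b, (t - u) ^ (ρ - 1) * X t := by
      intro u hu
      have h1 := integral_mul_integral_rpow_swap (f := fun t => (t - u) ^ (ρ - 1)) (g := g)
        (p := 1 - σ) (M := M) hu.2.le (by linarith)
        (intervalIntegrable_sub_rpow (by linarith) u u b) hgc.aestronglyMeasurable
        (fun y hy => hM y ⟨(hu.1.trans hy.1).le, hy.2⟩)
      have e : 1 - σ - 1 = -σ := by ring
      rw [e] at h1
      simp only [hX]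
      rw [h1, ← intervalIntegral.integral_const_mul]
      refine intervalIntegral.integral_congr_uIoo fun s hs => ?_
      rw [uIoo_of_le hu.2.le] at hs
      have h2 := hB u s hs.1
      rw [e] at h2
      rw [h2]
      field_simp
    have hXM : ∀ t ∈ Ioc 0 b, |X t| ≤ M * (b ^ (1 - σ) / (1 - σ)) := by
      intro t ht
      refine (abs_integral_rpow_mul_le hσ1 ht.2
        fun s hs => hM s ⟨(ht.1.trans hs.1).le, hs.2⟩).trans ?_
      have : 0 < 1 - σ := by linarith
      gcongr
      · linarith [ht.2]
      · linarith [ht.1]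
    have hswap := integral_mul_integral_rpow_swap (f := h) (g := X) (p := ρ) hb.le hρ0 hh
      ((measurable_integral_rpow_mul hgc.measurable b (-σ)).mono_measure
        (Measure.restrict_mono Ioc_subset_Iic_self le_rfl)) hXM
    have e3 : ∫ u in (0 : ℝ)..b, h u * ((-1) ^ (m + 1) / m.factorial *
        ∫ s in u..b, (s - u) ^ m * g s) = (-1) ^ (m + 1) / m.factorial * B⁻¹ *
        ∫ u in (0 : ℝ)..b, h u * ∫ t in u..b, (t - u) ^ (ρ - 1) * X t := by
      rw [← intervalIntegral.integral_const_mul]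
      refine intervalIntegral.integral_congr_uIoo fun u hu => ?_
      rw [uIoo_of_le hb.le] at hu
      rw [hsemi u hu]
      ring
    rw [e3, hswap, mul_assoc (_ * B⁻¹)]
    congr 1
    rw [← intervalIntegral.integral_const_mul]
    refine intervalIntegral.integral_congr fun t _ => ?_
    have hΓ : Real.Gamma ρ ≠ 0 := (Real.Gamma_pos_of_pos hρ0).ne'
    rw [fracInt, if_neg hρ0.ne']
    field_simp
    exact mul_comm _ _

/-! ### The derived conjugate series -/

theorem iteratedDeriv_conjTerm (f : ℝ → ℝ) (r n : ℕ) :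
    iteratedDeriv r (conjTerm f n) = fun x => (n : ℝ) ^ r *
      (fourierSinCoeff f n * Real.cos (n * x + r * (Real.pi / 2)) -
        fourierCosCoeff f n * Real.sin (n * x + r * (Real.pi / 2))) := by
  induction r with
  | zero => ext x; simp [conjTerm]
  | succ r ih =>
    rw [iteratedDeriv_succ, ih]
    ext x
    have h1 : HasDerivAt (fun u : ℝ => n * u + r * (Real.pi / 2)) (n : ℝ) x := by
      simpa using ((hasDerivAt_id x).const_mul (n : ℝ)).add_const (r * (Real.pi / 2))
    have h2 := (((h1.cos.const_mul (fourierSinCoeff f n)).sub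
      (h1.sin.const_mul (fourierCosCoeff f n))).const_mul ((n : ℝ) ^ r)).deriv
    refine Eq.trans h2 ?_
    have : (n : ℝ) * x + (r + 1 : ℕ) * (Real.pi / 2) =
        n * x + r * (Real.pi / 2) + Real.pi / 2 := by push_cast; ring
    rw [this, Real.sin_add_pi_div_two, Real.cos_add_pi_div_two]
    ring

theorem sin_sub_nat_mul_pi_div_two (r : ℕ) (a : ℝ) :
    Real.sin (a - r * (Real.pi / 2)) = (-1) ^ r * Real.sin (a + r * (Real.pi / 2)) := by
  have : a + r * (Real.pi / 2) = a - r * (Real.pi / 2) + r * Real.pi := by ring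
  rw [this, Real.sin_add_nat_mul_pi, ← mul_assoc, ← mul_pow]
  simp

/-- The coefficient integral of the derived conjugate series, shifted to be centred at `x`. -/
theorem derivedConjTerm_eq_integral {f : ℝ → ℝ} (hper : Function.Periodic f (2 * Real.pi))
    (hf : IntervalIntegrable f volume (-Real.pi) Real.pi) (r : ℕ) (x : ℝ) (n : ℕ) :
    derivedConjTerm f r x n = (-1) ^ r / Real.pi * ∫ u in (-Real.pi)..Real.pi,
      f (x + u) * ((n : ℝ) ^ r * Real.sin (n * u + r * (Real.pi / 2))) := by
  have h1 : derivedConjTerm f r x n = 1 / Real.pi * ∫ t in (-Real.pi)..Real.pi,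
      f t * ((n : ℝ) ^ r * Real.sin (n * (t - x) - r * (Real.pi / 2))) := by
    rw [derivedConjTerm, iteratedDeriv_conjTerm, fourierSinCoeff, fourierCosCoeff]
    have e : ∀ t : ℝ, f t * ((n : ℝ) ^ r * Real.sin (n * (t - x) - r * (Real.pi / 2))) =
        ((n : ℝ) ^ r * Real.cos (n * x + r * (Real.pi / 2))) * (f t * Real.sin (n * t)) -
        ((n : ℝ) ^ r * Real.sin (n * x + r * (Real.pi / 2))) * (f t * Real.cos (n * t)) := by
      intro t
      have : (n : ℝ) * (t - x) - r * (Real.pi / 2) = n * t - (n * x + r * (Real.pi / 2)) := by ring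
      rw [this, Real.sin_sub]; ring
    simp_rw [e]
    rw [intervalIntegral.integral_sub ((hf.mul_continuousOn (by fun_prop)).const_mul _)
      ((hf.mul_continuousOn (by fun_prop)).const_mul _), intervalIntegral.integral_const_mul,
      intervalIntegral.integral_const_mul]
    ring
  have h2 : ∫ t in (-Real.pi)..Real.pi,
      f t * ((n : ℝ) ^ r * Real.sin (n * (t - x) - r * (Real.pi / 2))) =
      ∫ u in (-Real.pi)..Real.pi,
        f (x + u) * ((n : ℝ) ^ r * Real.sin (n * u - r * (Real.pi / 2))) := by
    set F : ℝ → ℝ := fun t => f t * ((n : ℝ) ^ r * Real.sin (n * (t - x) - r * (Real.pi / 2)))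
      with hF
    have hFper : Function.Periodic F (2 * Real.pi) := by
      intro t
      have e : (n : ℝ) * (t + 2 * Real.pi - x) - r * (Real.pi / 2) =
        n * (t - x) - r * (Real.pi / 2) + n * (2 * Real.pi) := by ring
      simp only [hF]
      rw [hper t, e, Real.sin_add_nat_mul_two_pi]
    have h := hFper.intervalIntegral_add_eq (-Real.pi) (x - Real.pi)
    have e1 : -Real.pi + 2 * Real.pi = Real.pi := by ring
    have e2 : x - Real.pi + 2 * Real.pi = x + Real.pi := by ring
    rw [e1, e2] at h
    rw [h]
    have h3 := intervalIntegral.integral_comp_add_left (a := -Real.pi) (b := Real.pi) F x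
    rw [← sub_eq_add_neg] at h3
    rw [← h3]
    refine intervalIntegral.integral_congr fun u _ => ?_
    simp only [hF, add_sub_cancel_left]
  rw [h1, h2]
  simp_rw [sin_sub_nat_mul_pi_div_two]
  rw [← intervalIntegral.integral_const_mul, ← intervalIntegral.integral_const_mul]
  exact intervalIntegral.integral_congr fun u _ => by ring

theorem intervalIntegrable_comp_add_left_of_periodic {f : ℝ → ℝ}
    (hper : Function.Periodic f (2 * Real.pi))
    (hf : IntervalIntegrable f volume (-Real.pi) Real.pi) (x a b : ℝ) :
    IntervalIntegrable (fun u => f (x + u)) volume a b := by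
  have h : IntervalIntegrable f volume (x + a) (x + b) :=
    hper.intervalIntegrable (t := -Real.pi) Real.two_pi_pos.ne' (by
      have : -Real.pi + 2 * Real.pi = Real.pi := by ring
      rwa [this]) _ _
  have := h.comp_add_left x
  simpa using this

theorem sum_derivedConjTerm_eq_integral {f : ℝ → ℝ} (hper : Function.Periodic f (2 * Real.pi))
    (hf : IntervalIntegrable f volume (-Real.pi) Real.pi) (q : ℝ → ℝ) (r : ℕ) (x w : ℝ) :
    ∑ n ∈ Finset.Icc 1 ⌊w⌋₊, (n : ℝ) * derivedConjTerm f r x n * q ((n : ℝ) / w) =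
      (-1) ^ r / Real.pi * ∫ u in (-Real.pi)..Real.pi, f (x + u) * kernelSum q r w u := by
  have hfx := intervalIntegrable_comp_add_left_of_periodic hper hf x (-Real.pi) Real.pi
  simp_rw [kernelSum, Finset.mul_sum]
  rw [intervalIntegral.integral_finsetSum fun n _ => hfx.mul_continuousOn (by fun_prop),
    Finset.mul_sum]
  refine Finset.sum_congr rfl fun n _ => ?_
  rw [derivedConjTerm_eq_integral hper hf, ← intervalIntegral.integral_const_mul,
    ← intervalIntegral.integral_const_mul, ← intervalIntegral.integral_const_mul,
    ← intervalIntegral.integral_mul_const]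
  exact intervalIntegral.integral_congr fun u _ => by ring

theorem kernelSum_neg (q : ℝ → ℝ) (j : ℕ) (w u : ℝ) :
    kernelSum q j w (-u) = (-1) ^ (j + 1) * kernelSum q j w u := by
  rw [kernelSum, kernelSum, Finset.mul_sum]
  refine Finset.sum_congr rfl fun n _ => ?_
  have : (n : ℝ) * -u + j * (Real.pi / 2) = -(n * u - j * (Real.pi / 2)) := by ring
  rw [this, Real.sin_neg, sin_sub_nat_mul_pi_div_two, pow_succ]
  ring

/-- The kernel has the parity of `r + 1`, so the integral folds onto `(0, π)`. -/
theorem integral_mul_kernelSum_fold {F : ℝ → ℝ}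
    (hF : IntervalIntegrable F volume (-Real.pi) Real.pi) (q : ℝ → ℝ) (r : ℕ) (w : ℝ) :
    ∫ u in (-Real.pi)..Real.pi, F u * kernelSum q r w u =
      ∫ u in (0 : ℝ)..Real.pi, (F u - (-1) ^ r * F (-u)) * kernelSum q r w u := by
  have hπ := Real.pi_pos
  have hc : Continuous (kernelSum q r w) := (contDiff_kernelSum q r w (n := 0)).continuous
  have h1 : IntervalIntegrable F volume (-Real.pi) 0 := hF.mono_set (by
    rw [uIcc_of_le (by linarith), uIcc_of_le (by linarith)]
    exact Icc_subset_Icc_right hπ.le)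
  have h2 : IntervalIntegrable F volume 0 Real.pi := hF.mono_set (by
    rw [uIcc_of_le (by linarith), uIcc_of_le (by linarith)]
    exact Icc_subset_Icc_left (by linarith))
  have h3 : IntervalIntegrable (fun u => F (-u)) volume 0 Real.pi := by
    have h := (IntervalIntegrable.iff_comp_neg (f := F)).mp h1
    simpa using h.symm
  rw [← intervalIntegral.integral_add_adjacent_intervals (h1.mul_continuousOn hc.continuousOn)
    (h2.mul_continuousOn hc.continuousOn)]
  have h4 := intervalIntegral.integral_comp_neg (a := 0) (b := Real.pi)
    (fun u => F u * kernelSum q r w u)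
  rw [neg_zero] at h4
  rw [← h4, ← intervalIntegral.integral_add]
  · refine intervalIntegral.integral_congr fun u _ => ?_
    simp only [kernelSum_neg, pow_succ]
    ring
  · simp_rw [kernelSum_neg]
    exact h3.mul_continuousOn (by fun_prop)
  · exact h2.mul_continuousOn hc.continuousOn

/-- Powers below the order of the derivative contribute boundary values at `±π` only, after
repeated integration by parts. -/
theorem exists_abs_integral_pow_mul_kernelSum_le (i r : ℕ) (hi : i < r) :
    ∃ C : ℝ, 0 ≤ C ∧ ∀ (q : ℝ → ℝ) (w : ℝ),
      |∫ u in (-Real.pi)..Real.pi, u ^ i * kernelSum q r w u| ≤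
        C * ∑ j ∈ Finset.range r, |kernelSum q j w Real.pi| := by
  induction r generalizing i with
  | zero => omega
  | succ r ih =>
    have hparts : ∀ (q : ℝ → ℝ) (w : ℝ),
        ∫ u in (-Real.pi)..Real.pi, u ^ i * kernelSum q (r + 1) w u =
        Real.pi ^ i * kernelSum q r w Real.pi - (-Real.pi) ^ i * kernelSum q r w (-Real.pi) -
          ∫ u in (-Real.pi)..Real.pi, (i * u ^ (i - 1)) * kernelSum q r w u := fun q w =>
      intervalIntegral.integral_mul_deriv_eq_deriv_mul (fun u _ => hasDerivAt_pow i u)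
        (fun u _ => hasDerivAt_kernelSum q r w u) ((by fun_prop : Continuous fun u : ℝ =>
          (i : ℝ) * u ^ (i - 1)).intervalIntegrable _ _)
        ((contDiff_kernelSum q (r + 1) w (n := 0)).continuous.intervalIntegrable _ _)
    have hbd : ∀ (q : ℝ → ℝ) (w : ℝ), |Real.pi ^ i * kernelSum q r w Real.pi -
        (-Real.pi) ^ i * kernelSum q r w (-Real.pi)| ≤
        2 * Real.pi ^ i * |kernelSum q r w Real.pi| := by
      intro q w
      refine (abs_sub _ _).trans (le_of_eq ?_)
      rw [kernelSum_neg, abs_mul, abs_mul, abs_mul, abs_pow, abs_pow, abs_pow, abs_neg, abs_neg,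
        abs_one, abs_of_pos Real.pi_pos]
      ring
    obtain ⟨C, hC0, hC⟩ : ∃ C : ℝ, 0 ≤ C ∧ ∀ (q : ℝ → ℝ) (w : ℝ),
        |∫ u in (-Real.pi)..Real.pi, (i * u ^ (i - 1)) * kernelSum q r w u| ≤
          C * ∑ j ∈ Finset.range r, |kernelSum q j w Real.pi| := by
      rcases Nat.eq_zero_or_pos i with rfl | hpos
      · exact ⟨0, le_rfl, fun q w => by simp⟩
      · obtain ⟨C, hC0, hC⟩ := ih (i - 1) (by omega)
        refine ⟨i * C, by positivity, fun q w => ?_⟩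
        simp_rw [mul_assoc]
        rw [intervalIntegral.integral_const_mul, abs_mul, Nat.abs_cast]
        gcongr
        exact hC q w
    refine ⟨C + 2 * Real.pi ^ i, by positivity, fun q w => ?_⟩
    rw [hparts, Finset.sum_range_succ]
    have e1 := hbd q w
    have e2 := hC q w
    have e3 : 0 ≤ ∑ j ∈ Finset.range r, |kernelSum q j w Real.pi| :=
      Finset.sum_nonneg fun _ _ => abs_nonneg _
    have e4 : 0 ≤ 2 * Real.pi ^ i * ∑ j ∈ Finset.range r, |kernelSum q j w Real.pi| := by positivity
    have e5 : 0 ≤ C * |kernelSum q r w Real.pi| := by positivity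
    refine (abs_sub _ _).trans ?_
    linarith

theorem exists_abs_integral_thetaPoly_mul_kernelSum_le (r : ℕ) (θ : ℕ → ℝ) :
    ∃ C : ℝ, 0 ≤ C ∧ ∀ (q : ℝ → ℝ) (w : ℝ),
      |∫ u in (-Real.pi)..Real.pi, thetaPoly r θ u * kernelSum q r w u| ≤
        C * ∑ j ∈ Finset.range r, |kernelSum q j w Real.pi| := by
  have h : ∀ i ∈ Finset.range r, ∃ C : ℝ, 0 ≤ C ∧ ∀ (q : ℝ → ℝ) (w : ℝ),
      |∫ u in (-Real.pi)..Real.pi, u ^ i * kernelSum q r w u| ≤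
        C * ∑ j ∈ Finset.range r, |kernelSum q j w Real.pi| := fun i hi =>
    exists_abs_integral_pow_mul_kernelSum_le i r (Finset.mem_range.mp hi)
  choose! C hC0 hC using h
  refine ⟨∑ i ∈ Finset.range r, |θ i / (i.factorial : ℝ)| * C i,
    Finset.sum_nonneg fun i hi => mul_nonneg (abs_nonneg _) (hC0 i hi), fun q w => ?_⟩
  have hc : Continuous (kernelSum q r w) := (contDiff_kernelSum q r w (n := 0)).continuous
  simp_rw [thetaPoly, Finset.sum_mul]
  rw [intervalIntegral.integral_finsetSum fun i _ => (by fun_prop : Continuous fun u : ℝ =>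
    θ i / (i.factorial : ℝ) * u ^ i * kernelSum q r w u).intervalIntegrable _ _]
  refine (Finset.abs_sum_le_sum_abs _ _).trans (Finset.sum_le_sum fun i hi => ?_)
  simp_rw [mul_assoc]
  rw [intervalIntegral.integral_const_mul, abs_mul]
  gcongr
  exact hC i hi q w

/-- The summation means of the derived conjugate series in terms of `h`, up to the contribution of
the polynomial `P`. -/
theorem sum_derivedConjTerm_eq {f : ℝ → ℝ} (hper : Function.Periodic f (2 * Real.pi))
    (hf : IntervalIntegrable f volume (-Real.pi) Real.pi) (q : ℝ → ℝ) (r : ℕ) (θ : ℕ → ℝ)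
    (x w : ℝ) :
    ∑ n ∈ Finset.Icc 1 ⌊w⌋₊, (n : ℝ) * derivedConjTerm f r x n * q ((n : ℝ) / w) =
      (-1) ^ r / Real.pi * (2 * (∫ u in (0 : ℝ)..Real.pi,
          hFun f x r θ u * weightedKernel q r w u) +
        ∫ u in (-Real.pi)..Real.pi, thetaPoly r θ u * kernelSum q r w u) := by
  rw [sum_derivedConjTerm_eq_integral hper hf]
  congr 1
  have hfx := intervalIntegrable_comp_add_left_of_periodic hper hf x (-Real.pi) Real.pi
  have hP : Continuous (thetaPoly r θ) := by unfold thetaPoly; fun_prop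
  have hc : Continuous (kernelSum q r w) := (contDiff_kernelSum q r w (n := 0)).continuous
  have hfP : IntervalIntegrable (fun u => f (x + u) - thetaPoly r θ u) volume (-Real.pi) Real.pi :=
    hfx.sub (hP.intervalIntegrable _ _)
  have h1 := integral_mul_kernelSum_fold hfP q r w
  have h2 : ∫ u in (-Real.pi)..Real.pi, f (x + u) * kernelSum q r w u =
      (∫ u in (-Real.pi)..Real.pi, (f (x + u) - thetaPoly r θ u) * kernelSum q r w u) +
      ∫ u in (-Real.pi)..Real.pi, thetaPoly r θ u * kernelSum q r w u := by
    rw [← intervalIntegral.integral_add (hfP.mul_continuousOn hc.continuousOn)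
      ((by fun_prop : Continuous fun u =>
        thetaPoly r θ u * kernelSum q r w u).intervalIntegrable _ _)]
    exact intervalIntegral.integral_congr fun u _ => by ring
  rw [h2, h1, ← intervalIntegral.integral_const_mul]
  congr 1
  refine intervalIntegral.integral_congr_uIoo fun u hu => ?_
  rw [uIoo_of_le Real.pi_pos.le] at hu
  have hu0 : u ^ r ≠ 0 := pow_ne_zero _ hu.1.ne'
  rw [hFun, weightedKernel, ← sub_eq_add_neg]
  field_simp

/-! ### Measurability and the exchange of integrals -/

namespace IsNevanlinnaKernel

variable {α : ℝ} {q : ℝ → ℝ} {κ : ℕ}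

/-- Only values of `kerTail` on `[0, 1]` enter, where it is monotone. -/
theorem measurable_tailProfile (hq : IsNevanlinnaKernel α q) (hκ : ⌊α⌋₊ = κ + 1) (σ ρ : ℝ) :
    Measurable (tailProfile q (κ + 1) σ ρ) := by
  have hmono := hq.kerTail_monotoneOn hκ
  obtain ⟨K, hK, hKeq⟩ := hmono.exists_monotone_extension
    ⟨kerTail q (κ + 1) 0, by
      rintro _ ⟨y, hy, rfl⟩; exact hmono ⟨le_rfl, zero_le_one⟩ hy hy.1⟩
    ⟨kerTail q (κ + 1) 1, by
      rintro _ ⟨y, hy, rfl⟩; exact hmono hy ⟨zero_le_one, le_rfl⟩ hy.2⟩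
  have hKm : Measurable K := hK.measurable
  have h : tailProfile q (κ + 1) σ ρ =
      fun v => if v ≤ 1 then v ^ ρ else v ^ (σ - 1) * K (1 / v) + v ^ (σ - 3) := by
    ext v
    rw [tailProfile]
    split_ifs with hv
    · rfl
    · have hv1 : 1 < v := not_le.mp hv
      have hv0 : 0 < v := by linarith
      rw [hKeq ⟨by positivity, by rw [div_le_one hv0]; exact hv1.le⟩]
  rw [h]
  refine Measurable.ite measurableSet_Iic (by fun_prop) ?_
  have : Measurable fun v : ℝ => K (1 / v) := hKm.comp (by fun_prop)
  fun_prop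

theorem aestronglyMeasurable_sum (hq : IsNevanlinnaKernel α q) (hκ : ⌊α⌋₊ = κ + 1) (u : ℕ → ℝ) :
    AEStronglyMeasurable
      (fun w : ℝ => |∑ n ∈ Finset.Icc 1 ⌊w⌋₊, (n : ℝ) * u n * q ((n : ℝ) / w)| / w ^ 2)
      (volume.restrict (Ioi 1)) := by
  set q' : ℝ → ℝ := (Ioc (0 : ℝ) 1).indicator q with hq'
  have hq'm : Measurable q' := by
    refine measurable_of_restrict_of_restrict_compl (s := Ioc (0 : ℝ) 1) measurableSet_Ioc ?_ ?_
    · have h1 : (Ioc (0 : ℝ) 1).domRestrict q' = (Ioc (0 : ℝ) 1).domRestrict q := by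
        ext y
        exact indicator_of_mem y.2 _
      rw [h1]
      exact (continuousOn_iff_continuous_domRestrict.mp (hq.continuousOn_Ioc hκ)).measurable
    · have h1 : (Ioc (0 : ℝ) 1)ᶜ.domRestrict q' = fun _ => 0 := by
        ext y
        exact indicator_of_notMem y.2 _
      rw [h1]
      exact measurable_const
  have hF : Measurable fun w : ℝ =>
      |∑ n ∈ Finset.Icc 1 ⌊w⌋₊, (n : ℝ) * u n * q' ((n : ℝ) / w)| / w ^ 2 := by
    refine Measurable.div (measurable_natFloor_apply (F := fun M w =>
      |∑ n ∈ Finset.Icc 1 M, (n : ℝ) * u n * q' ((n : ℝ) / w)|) fun M => ?_) (by fun_prop)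
    have h1 : Measurable fun w : ℝ => ∑ n ∈ Finset.Icc 1 M, (n : ℝ) * u n * q' ((n : ℝ) / w) :=
      Finset.measurable_fun_sum (Finset.Icc 1 M)
        (f := fun (n : ℕ) (w : ℝ) => (n : ℝ) * u n * q' ((n : ℝ) / w)) fun n _ =>
          (hq'm.comp (measurable_const.div measurable_id)).const_mul _
    exact h1.abs
  refine hF.aestronglyMeasurable.congr ?_
  refine (ae_restrict_iff' measurableSet_Ioi).mpr (Filter.Eventually.of_forall fun w hw => ?_)
  have hw0 : (0 : ℝ) < w := zero_lt_one.trans hw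
  simp only []
  congr 2
  refine Finset.sum_congr rfl fun n hn => ?_
  rw [Finset.mem_Icc] at hn
  have hn1 : (1 : ℝ) ≤ n := by exact_mod_cast hn.1
  have hnw : (n : ℝ) ≤ w := (Nat.le_floor_iff hw0.le).mp hn.2
  rw [hq', indicator_of_mem]
  exact ⟨by positivity, (div_le_one hw0).mpr hnw⟩

/-- The Tonelli step: by scaling, the integral of `D (w * t)` over `w` is `t⁻¹` times that of `D`. -/
theorem integrable_prod_tailProfile (hq : IsNevanlinnaKernel α q) (hκ : ⌊α⌋₊ = κ + 1) {σ ρ : ℝ}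
    (hσ : σ = α - (κ + 1)) (hσ1 : σ < 1) (hρ : 0 ≤ ρ) {g : ℝ → ℝ} {b : ℝ}
    (hg : IntegrableOn g (Ioo 0 b)) :
    Integrable (fun z : ℝ × ℝ => z.2 * g z.2 * tailProfile q (κ + 1) σ ρ (z.1 * z.2))
      ((volume.restrict (Ioi 0)).prod (volume.restrict (Ioo 0 b))) := by
  set D := tailProfile q (κ + 1) σ ρ with hD
  have hDi : IntegrableOn D (Ioi 0) := hq.integrableOn_tailProfile hκ hσ hσ1 hρ
  have hDm : Measurable D := hq.measurable_tailProfile hκ σ ρ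
  have hmeas : AEStronglyMeasurable (fun z : ℝ × ℝ => z.2 * g z.2 * D (z.1 * z.2))
      ((volume.restrict (Ioi 0)).prod (volume.restrict (Ioo 0 b))) := by
    refine AEStronglyMeasurable.mul (AEStronglyMeasurable.mul
      measurable_snd.aestronglyMeasurable hg.aestronglyMeasurable.comp_snd) ?_
    exact (hDm.comp (measurable_fst.mul measurable_snd)).aestronglyMeasurable
  rw [integrable_prod_iff' hmeas]
  constructor
  · refine (ae_restrict_iff' measurableSet_Ioo).mpr (Filter.Eventually.of_forall fun t ht => ?_)
    have h1 : IntegrableOn (fun w => D (w * t)) (Ioi 0) :=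
      (integrableOn_Ioi_comp_mul_right_iff D 0 ht.1).mpr (by simpa using hDi)
    exact Integrable.const_mul h1 (t * g t)
  · have h1 : ∀ t ∈ Ioo 0 b, ∫ w in Ioi 0, ‖t * g t * D (w * t)‖ =
        |g t| * ∫ v in Ioi 0, |D v| := by
      intro t ht
      have ht0 := ht.1
      have h2 := integral_comp_mul_right_Ioi (fun v => |D v|) 0 ht0
      rw [zero_mul] at h2
      simp_rw [norm_mul, Real.norm_eq_abs]
      rw [integral_const_mul, h2, smul_eq_mul, abs_of_pos ht0]
      field_simp
    exact (hg.abs.mul_const _).congr ((ae_restrict_iff' measurableSet_Ioo).mpr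
      (Filter.Eventually.of_forall fun t ht => (h1 t ht).symm))

end IsNevanlinnaKernel

end

theorem theorem2 (f : ℝ → ℝ) (hper : Function.Periodic f (2 * Real.pi))
    (hf : IntervalIntegrable f volume (-Real.pi) Real.pi)
    (x α : ℝ) (r : ℕ) (θ : ℕ → ℝ) (q : ℝ → ℝ) (hq : IsNevanlinnaKernel α q)
    (ρ : ℝ) (hρ : ρ = α - (r : ℝ) - 1) (hρ0 : 0 ≤ ρ)
    (hint : IntegrableOn (hFun f x r θ) (Ioo 0 Real.pi) volume)
    (hmean : IntegrableOn (fun t => t⁻¹ * |fracMean (hFun f x r θ) ρ t|)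
      (Ioo 0 Real.pi) volume) :
    AbsNSummable q (derivedConjTerm f r x) := by
  have hα : ((r + 1 : ℕ) : ℝ) ≤ α := by push_cast; linarith
  have hα0 : 0 ≤ α := le_trans (by positivity) hα
  have hfl : r + 1 ≤ ⌊α⌋₊ := Nat.le_floor hα
  obtain ⟨m, hm⟩ := Nat.exists_eq_add_of_le hfl
  obtain ⟨κ, hκm⟩ : ∃ κ, κ = r + m := ⟨_, rfl⟩
  have hκ : ⌊α⌋₊ = κ + 1 := by omega
  set σ : ℝ := α - (κ + 1) with hσ
  have hσ0 : 0 ≤ σ := by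
    have := Nat.floor_le hα0
    rw [hκ] at this; push_cast at this; linarith
  have hσ1 : σ < 1 := by
    have := Nat.lt_floor_add_one α
    rw [hκ] at this; push_cast at this; linarith
  have hρm : ρ = m + σ := by rw [hρ, hσ, hκm]; push_cast; ring
  set h := hFun f x r θ with hh
  set D := tailProfile q (κ + 1) σ ρ with hD
  have hπ := Real.pi_pos
  have hhi : IntervalIntegrable h volume 0 Real.pi :=
    (intervalIntegrable_iff_integrableOn_Ioo_of_le hπ.le).mpr hint
  obtain ⟨c, c', hcG⟩ := exists_integral_mul_eq_fracInt hπ hhi hσ0 hσ1 hρm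
  obtain ⟨Cθ, hCθ0, hCθ⟩ := exists_abs_integral_thetaPoly_mul_kernelSum_le r θ
  obtain ⟨CX, hCX0, hCX⟩ :=
    hq.exists_abs_fracDeriv_weightedKernel_le hκ hκm hσ0 hσ1 hρm
  have hG : ∀ i ∈ Finset.range (m + 1), ∃ C : ℝ, 0 ≤ C ∧ ∀ w : ℝ, 1 ≤ w →
      |iteratedDeriv i (weightedKernel q r w) Real.pi| / w ^ 2 ≤ C * D (w * Real.pi) :=
    fun i hi => hq.exists_abs_iteratedDeriv_weightedKernel_pi_le hκ hκm hσ0 ρ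
      (Nat.lt_succ_iff.mp (Finset.mem_range.mp hi))
  have hS : ∀ j ∈ Finset.range r, ∃ C : ℝ, 0 ≤ C ∧ ∀ w : ℝ, 1 ≤ w →
      |kernelSum q j w Real.pi| / w ^ 2 ≤ C * D (w * Real.pi) :=
    fun j hj => hq.exists_abs_kernelSum_pi_le hκ hσ0 ρ (by
      have := Finset.mem_range.mp hj; omega)
  choose! CG _ hCG using hG
  choose! CS _ hCS using hS
  set μ : ℝ → ℝ := fun t => t⁻¹ * |fracMean h ρ t| with hμ
  have hΓ : 0 < Real.Gamma (1 + ρ) := Real.Gamma_pos_of_pos (by linarith)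
  have hprod := hq.integrable_prod_tailProfile hκ hσ hσ1 hρ0 hmean
  set Ψ : ℝ → ℝ := fun w => ∫ t in Ioo 0 Real.pi, t * μ t * D (w * t) with hΨ
  have hΨi : IntegrableOn Ψ (Ioi 0) := hprod.integral_prod_left
  have hDπ : IntegrableOn (fun w => D (w * Real.pi)) (Ioi 0) :=
    (integrableOn_Ioi_comp_mul_right_iff D 0 hπ).mpr (by
      simpa using hq.integrableOn_tailProfile hκ hσ hσ1 hρ0)
  refine ⟨1, zero_lt_one, ?_⟩
  have hbound : IntegrableOn (fun w => 1 / Real.pi * (2 * ((∑ i ∈ Finset.range (m + 1),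
      |c i| * CG i) * D (w * Real.pi) + |c'| * (CX / Real.Gamma (1 + ρ) * Ψ w)) +
      Cθ * (∑ j ∈ Finset.range r, CS j) * D (w * Real.pi))) (Ioi 1) := by
    refine IntegrableOn.mono_set ?_ (Ioi_subset_Ioi zero_le_one)
    exact ((((hDπ.const_mul _).add ((hΨi.const_mul _).const_mul _)).const_mul _).add
      (hDπ.const_mul _)).const_mul _
  -- `Ψ w` is a finite integral for almost every `w` only
  refine Integrable.mono' hbound (hq.aestronglyMeasurable_sum hκ _) ?_
  have hae : ∀ᵐ w ∂(volume.restrict (Ioi 1)),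
      IntegrableOn (fun t => t * μ t * D (w * t)) (Ioo 0 Real.pi) :=
    (ae_mono (Measure.restrict_mono (Ioi_subset_Ioi zero_le_one) le_rfl)) hprod.prod_right_ae
  filter_upwards [hae, ae_restrict_mem measurableSet_Ioi] with w hw hw1
  have hw1' : (1 : ℝ) ≤ w := le_of_lt hw1
  have hw0 : 0 < w := zero_lt_one.trans hw1
  have hX : |∫ t in (0 : ℝ)..Real.pi, fracInt h ρ t * ∫ s in t..Real.pi,
      (s - t) ^ (-σ) * iteratedDeriv (m + 1) (weightedKernel q r w) s| / w ^ 2 ≤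
      CX / Real.Gamma (1 + ρ) * Ψ w := by
    rw [intervalIntegral.integral_of_le hπ.le, integral_Ioc_eq_integral_Ioo]
    have hpt : ∀ t ∈ Ioo 0 Real.pi, ‖fracInt h ρ t * ∫ s in t..Real.pi,
        (s - t) ^ (-σ) * iteratedDeriv (m + 1) (weightedKernel q r w) s‖ ≤
        w ^ 2 * (CX / Real.Gamma (1 + ρ)) * (t * μ t * D (w * t)) := by
      intro t ht
      have ht0 := ht.1
      have h1 := hCX w t hw0 ht
      rw [div_le_iff₀ (by positivity)] at h1
      have h2 : t * μ t = Real.Gamma (1 + ρ) * (t ^ (-ρ) * |fracInt h ρ t|) := by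
        simp only [hμ, fracMean]
        rw [abs_mul, abs_mul, abs_of_pos hΓ, abs_of_pos (Real.rpow_pos_of_pos ht0 _)]
        field_simp
      rw [h2, norm_mul, Real.norm_eq_abs, Real.norm_eq_abs]
      calc _ ≤ |fracInt h ρ t| * (CX * (t ^ (-ρ) * D (w * t)) * w ^ 2) := by gcongr
        _ = _ := by field_simp
    have h3 := norm_integral_le_of_norm_le (hw.const_mul (w ^ 2 * (CX / Real.Gamma (1 + ρ))))
      ((ae_restrict_iff' measurableSet_Ioo).mpr (Filter.Eventually.of_forall hpt))
    rw [integral_const_mul, Real.norm_eq_abs] at h3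
    rw [div_le_iff₀ (by positivity)]
    refine h3.trans (le_of_eq ?_)
    ring
  have hsumG : (∑ i ∈ Finset.range (m + 1),
      |c i| * |iteratedDeriv i (weightedKernel q r w) Real.pi|) / w ^ 2 ≤
      (∑ i ∈ Finset.range (m + 1), |c i| * CG i) * D (w * Real.pi) := by
    rw [Finset.sum_div, Finset.sum_mul]
    refine Finset.sum_le_sum fun i hi => ?_
    rw [mul_div_assoc, mul_assoc]
    exact mul_le_mul_of_nonneg_left (hCG i hi w hw1') (abs_nonneg _)
  have hsumS : (∑ j ∈ Finset.range r, |kernelSum q j w Real.pi|) / w ^ 2 ≤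
      (∑ j ∈ Finset.range r, CS j) * D (w * Real.pi) := by
    rw [Finset.sum_div, Finset.sum_mul]
    exact Finset.sum_le_sum fun j hj => hCS j hj w hw1'
  rw [Real.norm_eq_abs, abs_div, abs_abs, abs_of_pos (by positivity : (0 : ℝ) < w ^ 2),
    sum_derivedConjTerm_eq hper hf q r θ x w,
    hcG (weightedKernel q r w) (contDiff_weightedKernel q r w), abs_mul, abs_div, abs_pow, abs_neg,
    abs_one, one_pow, abs_of_pos hπ, mul_div_assoc]
  gcongr
  set X := ∫ t in (0 : ℝ)..Real.pi, fracInt h ρ t * ∫ s in t..Real.pi,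
      (s - t) ^ (-σ) * iteratedDeriv (m + 1) (weightedKernel q r w) s
  set P := ∫ u in (-Real.pi)..Real.pi, thetaPoly r θ u * kernelSum q r w u
  have e1 : |∑ i ∈ Finset.range (m + 1), c i * iteratedDeriv i (weightedKernel q r w) Real.pi| ≤
      ∑ i ∈ Finset.range (m + 1), |c i| * |iteratedDeriv i (weightedKernel q r w) Real.pi| :=
    (Finset.abs_sum_le_sum_abs _ _).trans (le_of_eq (Finset.sum_congr rfl fun i _ => abs_mul _ _))
  calc _ ≤ (2 * ((∑ i ∈ Finset.range (m + 1),
          |c i| * |iteratedDeriv i (weightedKernel q r w) Real.pi|) + |c'| * |X|) +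
        Cθ * ∑ j ∈ Finset.range r, |kernelSum q j w Real.pi|) / w ^ 2 := by
        gcongr
        refine (abs_add_le _ _).trans (add_le_add ?_ (hCθ q w))
        rw [abs_mul, abs_of_pos (by norm_num : (0 : ℝ) < 2)]
        gcongr
        refine (abs_add_le _ _).trans (add_le_add e1 ?_)
        rw [abs_mul]
    _ = 2 * ((∑ i ∈ Finset.range (m + 1),
          |c i| * |iteratedDeriv i (weightedKernel q r w) Real.pi|) / w ^ 2 +
          |c'| * (|X| / w ^ 2)) +
        Cθ * ((∑ j ∈ Finset.range r, |kernelSum q j w Real.pi|) / w ^ 2) := by ring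
    _ ≤ _ := by
        rw [mul_assoc Cθ]
        gcongr
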